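/- Let $0<\gamma<1$, $\lambda\in\mathbb R\setminus\{0\}$, $v_0\in\mathbb R$, and let $b:[0,\infty)\to\mathbb R$ be continuous and such that $\lim_{t\to\infty}e^{-Lt}|b(t)|=0$ for some $L>0$. Definitions. Let $u$ be the Heaviside function, $g_\alpha(t)=\frac{u(t)\,t^{\alpha-1}}{\Gamma(\alpha)}$ for $\alpha>0$, and $g_{-\gamma}=\frac{1}{\Gamma(1-\gamma)}D\big(u(t)t^{-\gamma}\big)\in\mathscr D'(\mathbb R)$, where $D$ is the distributional derivative. Let $X$ be the space of functions $\varphi\in L^1_{loc}[0,\infty)$ for which there is a (necessarily unique) number $C=:\varphi(0+)$ with $\lim_{t\to0^+}\frac1t\int_0^t|\varphi(s)-C|\,ds=0$. For $\varphi\in X$ the Caputo derivative is the distribution $D_c^\gamma\varphi=g_{-\gamma}*(u\varphi)-\varphi(0+)\,g_{1-\gamma}\in\mathscr D'(\mathbb R)$, with the convolution of distributions whose supports are bounded from the left. Let $$\mathcal E(\mathcal L)=\Big\{\varphi\in X:\ \exists L>0,\ \lim_{A\to\infty}\|e^{-Lt}\varphi\|_{L^\infty[A,\infty)}=0\Big\}.$$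 A solution of $D_c^\gamma v=\lambda v+b(t)$, $v(0)=v_0$, is a function $v\in X$ with $v(0+)=v_0$ such that $D_c^\gamma v=u(t)(\lambda v+b(t))$ in $\mathscr D'(\mathbb R)$. Claim. The problem $$D_c^\gamma v=\lambda v+b(t),\qquad v(0)=v_0$$ has a unique solution in $\mathcal E(\mathcal L)$ (unique up to equality almost everywhere on $[0,\infty)$), and it is given by $$v(t)=v_0\,e_{\gamma,\lambda}(t)+\frac1\lambda\int_0^t b(t-s)\,e_{\gamma,\lambda}'(s)\,ds,\qquad e_{\gamma,\lambda}(t)=E_\gamma(\lambda t^\gamma),\qquad E_\gamma(z)=\sum_{n=0}^\infty\frac{z^n}{\Gamma(\gamma n+1)}.$$ Here the series converges for every real $z$, $e_{\gamma,\lambda}$ is differentiable on $(0,\infty)$, and the integral converges absolutely for every $t\ge0$. -/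

import Mathlib

open MeasureTheory Set Filter Topology
open scoped Distributions ContDiff LineDeriv

/-! ### Distributions on the real line and their convolution -/

/-- `𝓓(ℝ) = C_c^∞(ℝ)`. -/
abbrev TestFn : Type := 𝓓((⊤ : TopologicalSpace.Opens ℝ), ℝ)

/-- `𝓓'(ℝ)`, the space of (real) distributions on the line. -/
abbrev Distr : Type := 𝓓'((⊤ : TopologicalSpace.Opens ℝ), ℝ)

/-- The distribution `ζ ↦ ∫ ζ(t) f(t) dt` attached to a locally integrable `f : ℝ → ℝ`
(only used for such `f`). -/
noncomputable def regularDistr (f : ℝ → ℝ) : Distr :=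
  TestFunction.integralAgainstBilinCLM (ContinuousLinearMap.mul ℝ ℝ) volume f

/-- The distribution `u(t) φ(t)`, where `u` is the Heaviside function, for a function `φ` that is
locally integrable on `[0, ∞)`. -/
noncomputable def causalDistr (φ : ℝ → ℝ) : Distr :=
  regularDistr (indicator (Ici 0) φ)

/-- A smooth partition of unity `(χ_i)_{i ∈ ℤ}` of the line, `χ_i` being supported in
`[i - 1, i + 1]`. -/
noncomputable def unityPart (i : ℤ) (t : ℝ) : ℝ :=
  Real.smoothTransition (t - i + 1) - Real.smoothTransition (t - i)

theorem unityPart_contDiff (i : ℤ) : ContDiff ℝ ∞ (unityPart i) := by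
  unfold unityPart
  exact (Real.smoothTransition.contDiff.comp (by fun_prop)).sub
    (Real.smoothTransition.contDiff.comp (by fun_prop))

theorem unityPart_eq_zero (i : ℤ) (t : ℝ) (ht : t ∉ Icc ((i : ℝ) - 1) (i + 1)) :
    unityPart i t = 0 := by
  unfold unityPart
  rw [mem_Icc, not_and_or, not_le, not_le] at ht
  rcases ht with h | h
  · rw [Real.smoothTransition.zero_of_nonpos (by linarith),
      Real.smoothTransition.zero_of_nonpos (by linarith), sub_zero]
  · rw [Real.smoothTransition.one_of_one_le (by linarith),
      Real.smoothTransition.one_of_one_le (by linarith), sub_self]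

theorem unityPart_hasCompactSupport (i : ℤ) : HasCompactSupport (unityPart i) :=
  HasCompactSupport.intro isCompact_Icc (fun t ht => unityPart_eq_zero i t ht)

theorem unityPart_mem_Icc (i : ℤ) (t : ℝ) : unityPart i t ∈ Icc (0 : ℝ) 1 := by
  unfold unityPart
  have h1 : Real.smoothTransition (t - i) ≤ Real.smoothTransition (t - i + 1) :=
    Real.smoothTransition.monotone (by linarith)
  have h2 := Real.smoothTransition.le_one (t - i + 1)
  have h3 := Real.smoothTransition.nonneg (t - i)
  exact ⟨by linarith, by linarith⟩

theorem finsum_unityPart (t : ℝ) : ∑ᶠ i : ℤ, unityPart i t = 1 := by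
  have hsub : (Function.support fun i : ℤ => unityPart i t) ⊆
      (({⌊t⌋, ⌊t⌋ + 1} : Finset ℤ) : Set ℤ) := by
    intro i hi
    have h1 := Int.floor_le t
    have h2 := Int.lt_floor_add_one t
    by_contra hne
    simp only [Finset.coe_insert, Finset.coe_singleton, mem_insert_iff, mem_singleton_iff,
      not_or] at hne
    apply hi
    show unityPart i t = 0
    unfold unityPart
    rcases lt_or_gt_of_ne hne.1 with h | h
    · have h' : (i : ℝ) + 1 ≤ ⌊t⌋ := by exact_mod_cast h
      rw [Real.smoothTransition.one_of_one_le (by linarith),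
        Real.smoothTransition.one_of_one_le (by linarith), sub_self]
    · have h' : (⌊t⌋ : ℝ) + 2 ≤ i := by
        have : ⌊t⌋ + 2 ≤ i := by omega
        exact_mod_cast this
      rw [Real.smoothTransition.zero_of_nonpos (by linarith),
        Real.smoothTransition.zero_of_nonpos (by linarith), sub_zero]
  rw [finsum_eq_sum_of_support_subset _ hsub, Finset.sum_pair (by omega)]
  have h1 := Int.floor_le t
  have h2 := Int.lt_floor_add_one t
  unfold unityPart
  push_cast
  rw [Real.smoothTransition.one_of_one_le (x := t - ⌊t⌋ + 1) (by linarith),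
    Real.smoothTransition.zero_of_nonpos (x := t - (⌊t⌋ + 1)) (by linarith),
    show t - ((⌊t⌋ : ℝ) + 1) + 1 = t - ⌊t⌋ by ring]
  ring

/-- The test function `t ↦ χ_i(t) ζ(s + t)`. -/
noncomputable def shiftedWindow (i : ℤ) (ζ : TestFn) (s : ℝ) : TestFn where
  toFun t := unityPart i t * ζ (s + t)
  contDiff' := (unityPart_contDiff i).mul (ζ.contDiff.comp (contDiff_const.add contDiff_id))
  hasCompactSupport' := (unityPart_hasCompactSupport i).mul_right
  tsupport_subset' := fun _ _ => trivial

open scoped Classical in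
/-- A smooth compactly supported function regarded as a test function (zero for other
functions). -/
noncomputable def asTestFn (ψ : ℝ → ℝ) : TestFn :=
  if h : ContDiff ℝ ∞ ψ ∧ HasCompactSupport ψ then ⟨ψ, h.1, h.2, fun _ _ => trivial⟩ else 0

/-- The convolution of two distributions whose supports are bounded from the left:
`⟨f * g, ζ⟩ = ∑_i ⟨f * (χ_i g), ζ⟩`, where, `χ_i g` being compactly supported,
`⟨f * (χ_i g), ζ⟩ = ⟨f_s, ⟨g_t, χ_i(t) ζ(s + t)⟩⟩`. The inner pairing is a smooth compactly
supported function of `s`, and only finitely many summands are nonzero. -/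
noncomputable def convDistr (f g : Distr) (ζ : TestFn) : ℝ :=
  ∑ᶠ i : ℤ, f (asTestFn fun s => g (shiftedWindow i ζ s))

/-! ### The convolution group and the Caputo derivative -/

/-- `g_α = u(t) t^(α-1) / Γ(α)` for `α > 0`. -/
noncomputable def gPos (α : ℝ) : Distr :=
  causalDistr fun t => t ^ (α - 1) / Real.Gamma α

/-- `g_{-γ} = D (u(t) t^(-γ)) / Γ(1-γ)` for `0 < γ < 1`, with `D` the distributional
derivative. -/
noncomputable def gNeg (γ : ℝ) : Distr :=
  ∂_{(1 : ℝ)} (gPos (1 - γ))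

/-- `C` is the right limit of `φ` at `0` in the averaged sense
`lim_{t → 0+} (1/t) ∫_0^t |φ - C| = 0`. -/
def HasInitialValue (φ : ℝ → ℝ) (C : ℝ) : Prop :=
  Tendsto (fun t : ℝ => (1 / t) * ∫ s in (0 : ℝ)..t, |φ s - C|) (𝓝[>] 0) (𝓝 0)

/-- The space `X` (for `T = ∞`): functions that are locally integrable on `[0, ∞)` and have an
initial value. Only the values on `[0, ∞)` matter. -/
def MemX (φ : ℝ → ℝ) : Prop :=
  LocallyIntegrableOn φ (Ici 0) volume ∧ ∃ C, HasInitialValue φ C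

open scoped Classical in
/-- `φ(0+)`, for `φ` in `X`. -/
noncomputable def initialValue (φ : ℝ → ℝ) : ℝ :=
  if h : ∃ C, HasInitialValue φ C then h.choose else 0

/-- The Caputo derivative of order `γ ∈ (0, 1)` of `φ` in `X`, as a functional on test functions:
`D_c^γ φ = g_{-γ} * (u φ) - φ(0+) g_{1-γ}`. -/
noncomputable def caputoDeriv (γ : ℝ) (φ : ℝ → ℝ) (ζ : TestFn) : ℝ :=
  convDistr (gNeg γ) (causalDistr φ) ζ - initialValue φ * gPos (1 - γ) ζ

/-- `v` is a solution on `[0, ∞)` of `D_c^γ v = f(t, v)`, `v(0) = v₀`: `v` belongs to `X`,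
`v(0+) = v₀`, `t ↦ f(t, v(t))` is locally integrable on `[0, ∞)`, and the equation holds in the
sense of distributions. -/
def IsFODESolution (γ : ℝ) (f : ℝ → ℝ → ℝ) (v₀ : ℝ) (v : ℝ → ℝ) : Prop :=
  MemX v ∧ initialValue v = v₀ ∧
    LocallyIntegrableOn (fun t => f t (v t)) (Ici 0) volume ∧
    ∀ ζ : TestFn, caputoDeriv γ v ζ = causalDistr (fun t => f t (v t)) ζ

/-- The class `𝓔(𝓛)`: the functions `φ` in `X` for which there is `L > 0` with
`‖e^{-Lt} φ‖_{L^∞[A, ∞)} → 0` as `A → ∞`. -/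
def MemEL (φ : ℝ → ℝ) : Prop :=
  MemX φ ∧ ∃ L : ℝ, 0 < L ∧
    Tendsto (fun A : ℝ => eLpNorm (fun t => Real.exp (-(L * t)) * φ t) ⊤
      (volume.restrict (Ici A))) atTop (𝓝 0)

/-! ### The Mittag-Leffler function -/

/-- `E_γ(z) = ∑_n z^n / Γ(γ n + 1)`. -/
noncomputable def mittagLeffler (γ z : ℝ) : ℝ :=
  ∑' n : ℕ, z ^ n / Real.Gamma (γ * n + 1)

/-- `e_{γ,μ}(t) = E_γ(μ t^γ)`. -/
noncomputable def mlExp (γ μ t : ℝ) : ℝ :=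
  mittagLeffler γ (μ * t ^ γ)

/-- `v(t) = v₀ e_{γ,μ}(t) + (1/μ) ∫_0^t b(t - s) e_{γ,μ}'(s) ds`. -/
noncomputable def linearFODEFormula (γ μ : ℝ) (b : ℝ → ℝ) (v₀ t : ℝ) : ℝ :=
  v₀ * mlExp γ μ t + (1 / μ) * ∫ s in (0 : ℝ)..t, b (t - s) * deriv (mlExp γ μ) s

/-! ### The two-parameter Mittag-Leffler function -/

/-! Write R(t) = t^(γ-1) E_{γ,γ}(μ t^γ) and e = e_{γ,μ}. Integrating the series termwise with
Euler's beta integral gives g_{1-γ} * R = e, and differentiating it gives e' = μ R on (0,∞) with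
e(0) = 1. Hence g_{-γ} * R = D(u e) = δ + μ R: the kernel R is the convolution inverse of g_{-γ} - μ
δ. Since e'/μ = R, the proposed formula is v = v₀ e + R * b. Then g_{-γ} * v = v₀ (g_{1-γ} + μ e) +
b + μ R * b, and subtracting v₀ g_{1-γ} leaves μ v + b. For uniqueness, the difference d of two
solutions satisfies g_{-γ} * d = μ d, and convolving with R gives d = 0.

All of this is carried out on the test-function side. Convolution with u f is transposed to
`forwardInt f`; these operators commute by Fubini (`forwardInt_forwardInt`, `forwardInt_comm`), and
the Caputo derivative reduces to them (`caputoDeriv_apply`). The two properties of R become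
`forwardInt_caputoKernel_mlResolvent` and `forwardInt_mlExp_deriv`; existence is
`caputo_identity_linearFODEFormula` and uniqueness `forwardInt_eq_zero_of_homogeneous`.

Convergence of the series and exponential growth of e both rest on the elementary bound x^a ≤
e^(x+1) Γ(a+1). -/

theorem rpow_le_exp_mul_Gamma {a x : ℝ} (ha : 0 ≤ a) (hx : 0 ≤ x) :
    x ^ a ≤ Real.exp (x + 1) * Real.Gamma (a + 1) := by
  have hint := Real.GammaIntegral_convergent (s := a + 1) (by linarith)
  have hsub : Ioc x (x + 1) ⊆ Ioi 0 := fun t ht => lt_of_le_of_lt hx ht.1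
  -- Only the window (x, x+1] of Euler's integral is kept; there t^a ≥ x^a and e^(-t) ≥ e^(-(x+1)).
  have h1 : ∫ t in Ioc x (x + 1), Real.exp (-(x + 1)) * x ^ a ≤ Real.Gamma (a + 1) := by
    rw [Real.Gamma_eq_integral (by linarith)]
    refine le_trans (setIntegral_mono_on continuous_const.integrableOn_Ioc (hint.mono_set hsub)
      measurableSet_Ioc fun t ht => ?_) (setIntegral_mono_set hint ?_ hsub.eventuallyLE)
    · rw [add_sub_cancel_right]
      have h2 : x ^ a ≤ t ^ a := Real.rpow_le_rpow hx ht.1.le ha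
      have h3 : Real.exp (-(x + 1)) ≤ Real.exp (-t) := Real.exp_le_exp.2 (by linarith [ht.2])
      gcongr
    · filter_upwards [ae_restrict_mem measurableSet_Ioi] with t ht
      have : (0 : ℝ) < t := ht
      simp only [Pi.zero_apply]
      positivity
  simp only [integral_const, measureReal_restrict_apply_univ, Real.volume_real_Ioc,
    add_sub_cancel_left, zero_le_one, sup_of_le_left, smul_eq_mul, one_mul] at h1
  calc x ^ a = Real.exp (x + 1) * (Real.exp (-(x + 1)) * x ^ a) := by
        rw [← mul_assoc, ← Real.exp_add]; simp
    _ ≤ _ := by gcongr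

/-- `E_{γ,β}(z) = ∑_n z^n / Γ(γ n + β)`. -/
noncomputable def mittagLefflerTwo (γ β z : ℝ) : ℝ :=
  ∑' n : ℕ, z ^ n / Real.Gamma (γ * n + β)

section

variable {γ β : ℝ}

theorem Gamma_mul_nat_add_pos (hγ : 0 < γ) (hβ : 0 < β) (n : ℕ) : 0 < Real.Gamma (γ * n + β) :=
  Real.Gamma_pos_of_pos (by positivity)

theorem summable_mittagLefflerTwo (hγ : 0 < γ) (hβ : 0 < β) (z : ℝ) :
    Summable fun n : ℕ => z ^ n / Real.Gamma (γ * n + β) := by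
  -- With x^γ = y, the Gamma bound controls y^n. The factor 2 leaves a geometric series in 1/2, and
  -- the +1 keeps x positive so that x^(-β) can be split off.
  set y : ℝ := 2 * (|z| + 1) with hy
  have hy0 : 0 < y := by positivity
  set x : ℝ := y ^ (1 / γ) with hx
  have hx0 : 0 < x := Real.rpow_pos_of_pos hy0 _
  have hxy : x ^ γ = y := by
    rw [hx, ← Real.rpow_mul hy0.le, one_div_mul_cancel hγ.ne', Real.rpow_one]
  have hs : Summable fun n : ℕ =>
      Real.exp (x + 1) * x ^ (-β) * (γ * (n * (1 / 2) ^ n) + β * (1 / 2) ^ n) := by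
    refine Summable.mul_left _ (Summable.add (Summable.mul_left _ ?_) (Summable.mul_left _ ?_))
    · simpa using summable_pow_mul_geometric_of_norm_lt_one 1 (r := (1 / 2 : ℝ)) (by norm_num)
    · exact summable_geometric_of_lt_one (by norm_num) (by norm_num)
  refine Summable.of_norm_bounded hs fun n => ?_
  have hG := Gamma_mul_nat_add_pos hγ hβ n
  have hc : 0 < γ * n + β := by positivity
  have h1 := rpow_le_exp_mul_Gamma hc.le hx0.le
  rw [Real.Gamma_add_one hc.ne', Real.rpow_add hx0, Real.rpow_mul hx0.le, hxy,
    Real.rpow_natCast] at h1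
  rw [norm_div, norm_pow, Real.norm_eq_abs, Real.norm_eq_abs, abs_of_pos hG, div_le_iff₀ hG]
  have h2 : |z| ^ n ≤ y ^ n * (1 / 2) ^ n := by
    rw [← mul_pow]
    refine pow_le_pow_left₀ (abs_nonneg _) ?_ n
    rw [hy]; linarith
  have h3 : y ^ n ≤ x ^ (-β) * (Real.exp (x + 1) * ((γ * n + β) * Real.Gamma (γ * n + β))) := by
    rw [Real.rpow_neg hx0.le, inv_mul_eq_div, le_div_iff₀ (Real.rpow_pos_of_pos hx0 _)]
    exact h1
  calc |z| ^ n ≤ y ^ n * (1 / 2) ^ n := h2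
    _ ≤ (x ^ (-β) * (Real.exp (x + 1) * ((γ * n + β) * Real.Gamma (γ * n + β)))) *
        (1 / 2) ^ n := by gcongr
    _ = _ := by ring

theorem abs_mittagLefflerTwo_le (hγ : 0 < γ) (hβ : 0 < β) {z y : ℝ} (h : |z| ≤ y) :
    |mittagLefflerTwo γ β z| ≤ mittagLefflerTwo γ β y := by
  have hb : ∀ n : ℕ, ‖z ^ n / Real.Gamma (γ * n + β)‖ ≤ y ^ n / Real.Gamma (γ * n + β) := by
    intro n
    have hG := Gamma_mul_nat_add_pos hγ hβ n
    rw [norm_div, norm_pow, Real.norm_eq_abs, Real.norm_eq_abs, abs_of_pos hG]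
    gcongr
  exact tsum_of_norm_bounded (summable_mittagLefflerTwo hγ hβ y).hasSum hb

/-- The Gamma bound at x^γ = 2|z| dominates the n-th term by e^(x+1) 2^(-n). At z = μ t^γ the
exponent is linear in t, which is what puts the formula in the class 𝓔(𝓛). -/
theorem abs_mittagLeffler_le_exp (hγ : 0 < γ) (z : ℝ) :
    |mittagLeffler γ z| ≤ 2 * Real.exp ((2 * |z|) ^ (1 / γ) + 1) := by
  set x : ℝ := (2 * |z|) ^ (1 / γ) with hx
  have hx0 : 0 ≤ x := by positivity
  have hxy : x ^ γ = 2 * |z| := by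
    rw [hx, ← Real.rpow_mul (by positivity), one_div_mul_cancel hγ.ne', Real.rpow_one]
  have hsum : HasSum (fun n : ℕ => Real.exp (x + 1) * (1 / 2 : ℝ) ^ n)
      (Real.exp (x + 1) * 2) := hasSum_geometric_two.mul_left _
  rw [mul_comm (2 : ℝ), ← Real.norm_eq_abs]
  refine tsum_of_norm_bounded hsum fun n => ?_
  have hG := Gamma_mul_nat_add_pos hγ one_pos n
  have h1 := rpow_le_exp_mul_Gamma (a := γ * n) (by positivity) hx0
  rw [Real.rpow_mul hx0, hxy, Real.rpow_natCast, mul_pow] at h1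
  rw [norm_div, norm_pow, Real.norm_eq_abs, Real.norm_eq_abs, abs_of_pos hG, div_le_iff₀ hG]
  have h2 : (0 : ℝ) < 2 ^ n := by positivity
  rw [one_div, inv_pow]
  calc |z| ^ n = (2 ^ n)⁻¹ * (2 ^ n * |z| ^ n) := by field_simp
    _ ≤ (2 ^ n)⁻¹ * (Real.exp (x + 1) * Real.Gamma (γ * n + 1)) := by gcongr
    _ = _ := by ring

theorem hasDerivAt_mittagLeffler (hγ : 0 < γ) (z : ℝ) :
    HasDerivAt (mittagLeffler γ) (mittagLefflerTwo γ γ z / γ) z := by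
  -- Here Γ(γ(n+1)+1) = γ(n+1) Γ(γn+γ), so the factor n+1 from differentiation cancels.
  have key : ∀ n : ℕ, ∀ y : ℝ, ((n + 1 : ℕ) : ℝ) * y ^ n / Real.Gamma (γ * (n + 1 : ℕ) + 1) =
      y ^ n / Real.Gamma (γ * n + γ) / γ := by
    intro n y
    have hG := Gamma_mul_nat_add_pos hγ hγ n
    rw [Real.Gamma_add_one (by positivity)]
    push_cast
    rw [show γ * ((n : ℝ) + 1) = γ * n + γ by ring,
      show γ * (n : ℝ) + γ = γ * (n + 1) by ring] at *
    field_simp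
  have hu : ∀ r : ℝ, Summable fun n : ℕ => (n : ℝ) * r ^ (n - 1) / Real.Gamma (γ * n + 1) := by
    intro r
    rw [← summable_nat_add_iff 1]
    refine ((summable_mittagLefflerTwo hγ hγ r).div_const γ).congr fun n => ?_
    rw [add_tsub_cancel_right]; exact (key n r).symm
  have h := hasDerivAt_tsum_of_isPreconnected (𝕜 := ℝ) (hu (|z| + 1))
    (g := fun (n : ℕ) y => y ^ n / Real.Gamma (γ * n + 1))
    (g' := fun (n : ℕ) y => (n : ℝ) * y ^ (n - 1) / Real.Gamma (γ * n + 1))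
    (t := Metric.ball 0 (|z| + 1)) (y₀ := 0) (y := z) Metric.isOpen_ball
    (convex_ball _ _).isPreconnected
    (fun n y _ => (hasDerivAt_pow n y).div_const _) ?_ (by simp; positivity)
    (summable_mittagLefflerTwo hγ one_pos 0) (by simp)
  · have hv : ∑' n : ℕ, (n : ℝ) * z ^ (n - 1) / Real.Gamma (γ * n + 1) =
        mittagLefflerTwo γ γ z / γ := by
      rw [(hu z).tsum_eq_zero_add, mittagLefflerTwo, ← tsum_div_const]
      simp only [Nat.cast_zero, zero_mul, zero_div, zero_add, add_tsub_cancel_right]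
      exact tsum_congr fun n => key n z
    rw [← hv]
    exact h
  · intro n y hy
    have hG := Gamma_mul_nat_add_pos hγ one_pos n
    have hy' : |y| ≤ |z| + 1 := by simpa using (mem_ball_zero_iff.1 hy).le
    rw [norm_div, norm_mul, norm_pow, Real.norm_eq_abs, Real.norm_eq_abs, Real.norm_eq_abs,
      abs_of_pos hG, abs_of_nonneg (Nat.cast_nonneg n)]
    gcongr

theorem continuous_mittagLeffler (hγ : 0 < γ) : Continuous (mittagLeffler γ) :=
  continuous_iff_continuousAt.2 fun z => (hasDerivAt_mittagLeffler hγ z).continuousAt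

theorem continuous_mittagLefflerTwo (hγ : 0 < γ) (hβ : 0 < β) :
    Continuous (mittagLefflerTwo γ β) := by
  refine continuous_iff_continuousAt.2 fun z => ?_
  have hon : ContinuousOn (mittagLefflerTwo γ β) (Metric.ball 0 (|z| + 1)) := by
    refine continuousOn_tsum (u := fun n : ℕ => (|z| + 1) ^ n / Real.Gamma (γ * n + β))
      (fun n => by fun_prop) (summable_mittagLefflerTwo hγ hβ _) fun n y hy => ?_
    have hG := Gamma_mul_nat_add_pos hγ hβ n
    have hy' : |y| ≤ |z| + 1 := by simpa using (mem_ball_zero_iff.1 hy).le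
    rw [norm_div, norm_pow, Real.norm_eq_abs, Real.norm_eq_abs, abs_of_pos hG]
    gcongr
  exact hon.continuousAt (Metric.isOpen_ball.mem_nhds (by simp))

/-- The resolvent kernel `t^(γ-1) E_{γ,γ}(μ t^γ)` of the equation `v = μ g_γ * v + g_γ * b`. -/
noncomputable def mlResolvent (γ μ t : ℝ) : ℝ :=
  t ^ (γ - 1) * mittagLefflerTwo γ γ (μ * t ^ γ)

theorem hasDerivAt_mlExp (hγ : 0 < γ) (μ : ℝ) {t : ℝ} (ht : 0 < t) :
    HasDerivAt (mlExp γ μ) (μ * mlResolvent γ μ t) t := by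
  have h1 : HasDerivAt (fun t : ℝ => μ * t ^ γ) (μ * (γ * t ^ (γ - 1))) t :=
    (Real.hasDerivAt_rpow_const (Or.inl ht.ne')).const_mul μ
  have h2 := (hasDerivAt_mittagLeffler hγ (μ * t ^ γ)).comp t h1
  refine h2.congr_deriv ?_
  unfold mlResolvent
  field_simp

theorem continuous_mlExp (hγ : 0 < γ) (μ : ℝ) : Continuous (mlExp γ μ) := by
  have h : Continuous fun t : ℝ => t ^ γ := Real.continuous_rpow_const hγ.le
  exact (continuous_mittagLeffler hγ).comp (continuous_const.mul h)

theorem mlExp_zero (hγ : 0 < γ) (μ : ℝ) : mlExp γ μ 0 = 1 := by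
  unfold mlExp
  rw [Real.zero_rpow hγ.ne', mul_zero, mittagLeffler, tsum_eq_single 0]
  · simp
  · intro n hn
    simp [hn]

theorem intervalIntegrable_mlResolvent (hγ : 0 < γ) (μ a c : ℝ) :
    IntervalIntegrable (mlResolvent γ μ) volume a c := by
  have h : Continuous fun t : ℝ => t ^ γ := Real.continuous_rpow_const hγ.le
  exact (intervalIntegral.intervalIntegrable_rpow' (by linarith)).mul_continuousOn
    ((continuous_mittagLefflerTwo hγ hγ).comp (continuous_const.mul h)).continuousOn

/-- Although R may be singular at 0, e is continuous there, so the fundamental theorem needs the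
derivative only on the open interval. -/
theorem integral_mlResolvent (hγ : 0 < γ) (μ : ℝ) {t : ℝ} (ht : 0 ≤ t) :
    ∫ s in (0 : ℝ)..t, μ * mlResolvent γ μ s = mlExp γ μ t - 1 := by
  rw [intervalIntegral.integral_eq_sub_of_hasDerivAt_of_le ht
    (continuous_mlExp hγ μ).continuousOn (fun s hs => hasDerivAt_mlExp hγ μ hs.1)
    ((intervalIntegrable_mlResolvent hγ μ 0 t).const_mul μ), mlExp_zero hγ]

theorem abs_mlResolvent_le (hγ : 0 < γ) (μ : ℝ) {t : ℝ} (ht : 0 ≤ t) :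
    |mlResolvent γ μ t| ≤ mlResolvent γ |μ| t := by
  unfold mlResolvent
  rw [abs_mul, abs_of_nonneg (Real.rpow_nonneg ht _)]
  refine mul_le_mul_of_nonneg_left (abs_mittagLefflerTwo_le hγ hγ ?_) (Real.rpow_nonneg ht _)
  rw [abs_mul, abs_of_nonneg (Real.rpow_nonneg ht _)]

theorem abs_mlExp_le_exp (hγ : 0 < γ) (μ : ℝ) {t : ℝ} (ht : 0 ≤ t) :
    |mlExp γ μ t| ≤ 2 * Real.exp ((2 * |μ|) ^ (1 / γ) * t + 1) := by
  have h := abs_mittagLeffler_le_exp hγ (μ * t ^ γ)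
  rwa [abs_mul, abs_of_nonneg (Real.rpow_nonneg ht γ), ← mul_assoc,
    Real.mul_rpow (by positivity) (by positivity), ← Real.rpow_mul ht,
    mul_one_div_cancel hγ.ne', Real.rpow_one] at h

/-! ### Beta integrals and the identity g_{1-γ} * R = e -/

theorem intervalIntegrable_rpow_mul_sub_rpow {a c t : ℝ} (ha : 0 < a) (hc : 0 < c) (ht : 0 < t) :
    IntervalIntegrable (fun s : ℝ => s ^ (a - 1) * (t - s) ^ (c - 1)) volume 0 t := by
  -- Cutting at t/2 separates the two endpoint singularities; the right half is the left one
  -- reflected, with a and c exchanged.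
  have half : ∀ a c : ℝ, 0 < a → IntervalIntegrable
      (fun s : ℝ => s ^ (a - 1) * (t - s) ^ (c - 1)) volume 0 (t / 2) := by
    intro a c ha
    refine (intervalIntegral.intervalIntegrable_rpow' (by linarith)).mul_continuousOn ?_
    refine ContinuousOn.rpow_const (by fun_prop) fun s hs => Or.inl ?_
    rw [uIcc_of_le (by linarith)] at hs
    linarith [hs.2]
  refine (half a c ha).trans ?_
  have h := ((half c a hc).comp_sub_left t).symm
  rw [sub_zero, sub_half] at h
  refine h.congr fun s _ => ?_
  simp only [sub_sub_cancel]
  ring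

theorem integral_rpow_mul_sub_rpow {a c t : ℝ} (ha : 0 < a) (hc : 0 < c) (ht : 0 < t) :
    ∫ s in (0 : ℝ)..t, s ^ (a - 1) * (t - s) ^ (c - 1) =
      t ^ (a + c - 1) * (Real.Gamma a * Real.Gamma c / Real.Gamma (a + c)) := by
  have h1 := Complex.betaIntegral_scaled (a : ℂ) (c : ℂ) ht
  rw [← ProbabilityTheory.beta, ProbabilityTheory.beta_eq_betaIntegralReal a c ha hc]
  have h2 : ∫ s in (0 : ℝ)..t, (s : ℂ) ^ ((a : ℂ) - 1) * ((t : ℂ) - s) ^ ((c : ℂ) - 1) =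
      ((∫ s in (0 : ℝ)..t, s ^ (a - 1) * (t - s) ^ (c - 1) : ℝ) : ℂ) := by
    rw [← intervalIntegral.integral_ofReal]
    refine intervalIntegral.integral_congr fun s hs => ?_
    rw [uIcc_of_le ht.le] at hs
    rw [Complex.ofReal_mul, Complex.ofReal_cpow hs.1, Complex.ofReal_cpow (sub_nonneg.2 hs.2)]
    push_cast
    rfl
  have h3 : (t : ℂ) ^ ((a : ℂ) + c - 1) = ((t ^ (a + c - 1) : ℝ) : ℂ) := by
    rw [Complex.ofReal_cpow ht.le]; push_cast; rfl
  rw [h2, h3] at h1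
  have h4 := congrArg Complex.re h1
  rwa [Complex.ofReal_re, Complex.re_ofReal_mul] at h4

/-- `g_{1-γ} * R = e_{γ,μ}`, where `R` is the resolvent kernel. -/
theorem integral_rpow_mul_mlResolvent (hγ0 : 0 < γ) (hγ1 : γ < 1) (μ : ℝ) {t : ℝ} (ht : 0 < t) :
    ∫ s in (0 : ℝ)..t, s ^ (1 - γ - 1) / Real.Gamma (1 - γ) * mlResolvent γ μ (t - s) =
      mlExp γ μ t := by
  have hΓ : 0 < Real.Gamma (1 - γ) := Real.Gamma_pos_of_pos (by linarith)
  let F : ℝ → ℕ → ℝ → ℝ := fun ν n s => ν ^ n / (Real.Gamma (1 - γ) * Real.Gamma (γ * n + γ)) *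
    (s ^ (1 - γ - 1) * (t - s) ^ (γ * n + γ - 1))
  have hF : ∀ ν n, IntegrableOn (F ν n) (Ioc 0 t) := fun ν n =>
    ((intervalIntegrable_iff_integrableOn_Ioc_of_le ht.le).1
      (intervalIntegrable_rpow_mul_sub_rpow (by linarith) (by positivity) ht)).const_mul _
  have hI : ∀ ν : ℝ, ∀ n : ℕ, ∫ s in Ioc 0 t, F ν n s =
      (ν * t ^ γ) ^ n / Real.Gamma (γ * n + 1) := by
    intro ν n
    have hG := Gamma_mul_nat_add_pos hγ0 hγ0 n
    rw [← intervalIntegral.integral_of_le ht.le, intervalIntegral.integral_const_mul,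
      integral_rpow_mul_sub_rpow (by linarith) (by positivity) ht,
      show 1 - γ + (γ * n + γ) = γ * n + 1 by ring, add_sub_cancel_right, Real.rpow_mul ht.le,
      Real.rpow_natCast, mul_pow]
    field_simp
  have hnorm : ∀ n, ∀ s ∈ Ioc 0 t, ‖F μ n s‖ = F |μ| n s := by
    intro n s hs
    have hG := Gamma_mul_nat_add_pos hγ0 hγ0 n
    simp only [F]
    rw [norm_mul, norm_div, norm_pow, Real.norm_eq_abs, Real.norm_of_nonneg (by positivity),
      Real.norm_of_nonneg (mul_nonneg (Real.rpow_nonneg hs.1.le _)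
        (Real.rpow_nonneg (sub_nonneg.2 hs.2) _))]
  -- Sum and integral may be exchanged because the norms are the same terms for |μ|, whose integrals
  -- sum to E_γ(|μ| t^γ).
  have hsum := hasSum_integral_of_summable_integral_norm (F := F μ) (μ := volume.restrict (Ioc 0 t))
    (hF μ) (by
      refine (summable_mittagLefflerTwo hγ0 one_pos (|μ| * t ^ γ)).congr fun n => ?_
      rw [setIntegral_congr_fun measurableSet_Ioc (hnorm n), hI])
  rw [intervalIntegral.integral_of_le ht.le]
  calc ∫ s in Ioc 0 t, s ^ (1 - γ - 1) / Real.Gamma (1 - γ) * mlResolvent γ μ (t - s)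
      = ∫ s in Ioc 0 t, ∑' n, F μ n s := by
        -- The endpoint s = t is dropped because splitting the power of t - s requires t - s > 0.
        rw [integral_Ioc_eq_integral_Ioo, integral_Ioc_eq_integral_Ioo]
        refine setIntegral_congr_fun measurableSet_Ioo fun s hs => ?_
        have hts : 0 < t - s := sub_pos.2 hs.2
        simp only [mlResolvent, mittagLefflerTwo]
        rw [← mul_assoc, ← tsum_mul_left]
        refine tsum_congr fun n => ?_
        have hG := Gamma_mul_nat_add_pos hγ0 hγ0 n
        simp only [F]
        rw [show γ * (n : ℝ) + γ - 1 = (γ - 1) + γ * n by ring, Real.rpow_add hts,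
          Real.rpow_mul hts.le, Real.rpow_natCast, mul_pow]
        field_simp
    _ = mlExp γ μ t := by
        rw [← hsum.tsum_eq]
        exact tsum_congr fun n => hI μ n

end

/-! ### Causal functions acting on test functions -/

/-- `f` is integrable on `(0, N]` for every `N`. -/
def CausalLocInt (f : ℝ → ℝ) : Prop :=
  ∀ N : ℝ, IntegrableOn f (Ioc 0 N)

/-- Continuous functions that vanish near `+∞`. -/
structure IsForwardTest (ψ : ℝ → ℝ) : Prop where
  continuous : Continuous ψ
  exists_eq_zero : ∃ M : ℝ, ∀ x, M ≤ x → ψ x = 0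

/-- `x ↦ ∫_0^∞ f(s) ψ(x + s) ds`, the transpose of the convolution with `u f`. -/
noncomputable def forwardInt (f ψ : ℝ → ℝ) (x : ℝ) : ℝ :=
  ∫ s in Ioi 0, f s * ψ (x + s)

/-- `∫_0^t f(s) g(t - s) ds`. -/
noncomputable def causalConv (f g : ℝ → ℝ) (t : ℝ) : ℝ :=
  ∫ s in (0 : ℝ)..t, f s * g (t - s)

theorem locallyIntegrableOn_Ici_iff_causalLocInt {f : ℝ → ℝ} :
    LocallyIntegrableOn f (Ici 0) volume ↔ CausalLocInt f := by
  rw [locallyIntegrableOn_iff isClosed_Ici.isLocallyClosed]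
  constructor
  · intro h N
    exact (h (Icc 0 N) Icc_subset_Ici_self isCompact_Icc).mono_set Ioc_subset_Icc_self
  · intro h k hk hc
    obtain ⟨N, hN⟩ := hc.bddAbove
    exact ((integrableOn_Icc_iff_integrableOn_Ioc).2 (h N)).mono_set fun x hx => ⟨hk hx, hN hx⟩

theorem CausalLocInt.add {f g : ℝ → ℝ} (hf : CausalLocInt f) (hg : CausalLocInt g) :
    CausalLocInt (fun t => f t + g t) := fun N => (hf N).add (hg N)

theorem CausalLocInt.sub {f g : ℝ → ℝ} (hf : CausalLocInt f) (hg : CausalLocInt g) :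
    CausalLocInt (fun t => f t - g t) := fun N => (hf N).sub (hg N)

theorem CausalLocInt.const_mul {f : ℝ → ℝ} (hf : CausalLocInt f) (c : ℝ) :
    CausalLocInt (fun t => c * f t) := fun N => (hf N).const_mul c

theorem CausalLocInt.mul_continuous {f g : ℝ → ℝ} (hf : CausalLocInt f) (hg : Continuous g) :
    CausalLocInt (fun t => f t * g t) := fun N =>
  (((integrableOn_Icc_iff_integrableOn_Ioc).2 (hf N)).mul_continuousOn hg.continuousOn
    isCompact_Icc).mono_set Ioc_subset_Icc_self

theorem ContinuousOn.causalLocInt {f : ℝ → ℝ} (hf : ContinuousOn f (Ici 0)) : CausalLocInt f :=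
  locallyIntegrableOn_Ici_iff_causalLocInt.1 (hf.locallyIntegrableOn measurableSet_Ici)

theorem CausalLocInt.intervalIntegrable {f : ℝ → ℝ} (hf : CausalLocInt f) {N : ℝ} (hN : 0 ≤ N) :
    IntervalIntegrable f volume 0 N :=
  (intervalIntegrable_iff_integrableOn_Ioc_of_le hN).2 (hf N)

namespace IsForwardTest

variable {ψ : ℝ → ℝ}

theorem const_mul (hψ : IsForwardTest ψ) (c : ℝ) : IsForwardTest (fun x => c * ψ x) := by
  obtain ⟨M, hM⟩ := hψ.exists_eq_zero
  exact ⟨hψ.continuous.const_mul c, M, fun x hx => by rw [hM x hx, mul_zero]⟩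

theorem exists_bound (hψ : IsForwardTest ψ) (a : ℝ) : ∃ C : ℝ, ∀ x, a ≤ x → |ψ x| ≤ C := by
  obtain ⟨M, hM⟩ := hψ.exists_eq_zero
  obtain ⟨C, hC⟩ := (isCompact_Icc (a := a) (b := M)).exists_bound_of_continuousOn
    hψ.continuous.continuousOn
  refine ⟨max C 0, fun x hx => ?_⟩
  rcases le_total x M with h | h
  · exact (hC x ⟨hx, h⟩).trans (le_max_left _ _)
  · rw [hM x h, abs_zero]
    exact le_max_right _ _

end IsForwardTest

theorem isForwardTest_of_hasCompactSupport {ψ : ℝ → ℝ} (hc : Continuous ψ)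
    (hs : HasCompactSupport ψ) : IsForwardTest ψ := by
  obtain ⟨M, hM⟩ := hs.isCompact.bddAbove
  refine ⟨hc, M + 1, fun x hx => image_eq_zero_of_notMem_tsupport fun h => ?_⟩
  have := hM h
  linarith

/-! ### Transposed convolution on forward test functions -/

section forwardInt

variable {f g ψ χ : ℝ → ℝ}

theorem integrableOn_mul_forwardTest (hf : CausalLocInt f) (hψ : IsForwardTest ψ) (x : ℝ) :
    IntegrableOn (fun s => f s * ψ (x + s)) (Ioi 0) := by
  obtain ⟨M, hM⟩ := hψ.exists_eq_zero
  have hc : Continuous fun s => ψ (x + s) := hψ.continuous.comp (by fun_prop)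
  refine (hf.mul_continuous hc (M - x)).of_forall_sdiff_eq_zero measurableSet_Ioi fun s hs => ?_
  have : M - x < s := by
    by_contra h
    exact hs.2 ⟨hs.1, not_lt.1 h⟩
  rw [hM (x + s) (by linarith), mul_zero]

theorem forwardInt_eq_intervalIntegral {N x : ℝ} (hN : 0 ≤ N) (h : ∀ s, N < s → ψ (x + s) = 0) :
    forwardInt f ψ x = ∫ s in (0 : ℝ)..N, f s * ψ (x + s) := by
  rw [forwardInt, intervalIntegral.integral_of_le hN]
  refine setIntegral_eq_of_subset_of_forall_sdiff_eq_zero measurableSet_Ioi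
    (Ioc_subset_Ioi_self : Ioc 0 N ⊆ Ioi 0) fun s hs => ?_
  have : N < s := by
    by_contra h'
    exact hs.2 ⟨hs.1, not_lt.1 h'⟩
  rw [h s this, mul_zero]

/-- This stability is why forward tests replace compactly supported functions: the support stays
bounded on the right but may spread to -∞. -/
theorem forwardInt_isForwardTest (hf : CausalLocInt f) (hψ : IsForwardTest ψ) :
    IsForwardTest (forwardInt f ψ) := by
  obtain ⟨M, hM⟩ := hψ.exists_eq_zero
  refine ⟨continuous_iff_continuousAt.2 fun x₀ => ?_, M, fun x hx => ?_⟩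
  · obtain ⟨C, hC⟩ := hψ.exists_bound (x₀ - 1)
    have hC0 : 0 ≤ C := (abs_nonneg _).trans (hC (x₀ - 1) le_rfl)
    -- For |x - x₀| < 1 the integrand vanishes beyond s = M - x₀ + 1 and ψ(x + s) is bounded by C,
    -- so one dominating function serves all such x.
    refine continuousAt_of_dominated
      (bound := indicator (Ioc 0 (M - x₀ + 1)) fun s => ‖f s‖ * C) ?_ ?_ ?_ ?_
    · exact Eventually.of_forall fun x => (integrableOn_mul_forwardTest hf hψ x).1
    · filter_upwards [Ioo_mem_nhds (sub_one_lt x₀) (lt_add_one x₀)] with x hx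
      filter_upwards [ae_restrict_mem measurableSet_Ioi] with s hs
      have hs0 : (0 : ℝ) < s := hs
      by_cases h : s ≤ M - x₀ + 1
      · rw [indicator_of_mem (show s ∈ Ioc 0 (M - x₀ + 1) from ⟨hs0, h⟩), norm_mul]
        gcongr
        exact hC _ (by linarith [hx.1])
      · rw [indicator_of_notMem (fun h' => h h'.2), hM (x + s) (by linarith [hx.1]), mul_zero,
          norm_zero]
    · exact ((integrable_indicator_iff measurableSet_Ioc).2
        ((hf _).norm.mul_const C)).restrict
    · exact Eventually.of_forall fun s =>
        (continuous_const.mul (hψ.continuous.comp (by fun_prop))).continuousAt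
  · rw [forwardInt]
    refine setIntegral_eq_zero_of_forall_eq_zero fun s hs => ?_
    have hs0 : (0 : ℝ) < s := hs
    rw [hM (x + s) (by linarith), mul_zero]

theorem forwardInt_add_left (hf : CausalLocInt f) (hg : CausalLocInt g) (hψ : IsForwardTest ψ)
    (x : ℝ) : forwardInt (fun t => f t + g t) ψ x = forwardInt f ψ x + forwardInt g ψ x := by
  unfold forwardInt
  simp_rw [add_mul]
  exact integral_add (integrableOn_mul_forwardTest hf hψ x) (integrableOn_mul_forwardTest hg hψ x)

theorem forwardInt_sub_left (hf : CausalLocInt f) (hg : CausalLocInt g) (hψ : IsForwardTest ψ)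
    (x : ℝ) : forwardInt (fun t => f t - g t) ψ x = forwardInt f ψ x - forwardInt g ψ x := by
  unfold forwardInt
  simp_rw [sub_mul]
  exact integral_sub (integrableOn_mul_forwardTest hf hψ x) (integrableOn_mul_forwardTest hg hψ x)

theorem forwardInt_const_mul_left (c : ℝ) (f ψ : ℝ → ℝ) (x : ℝ) :
    forwardInt (fun t => c * f t) ψ x = c * forwardInt f ψ x := by
  unfold forwardInt
  simp_rw [mul_assoc]
  exact integral_const_mul _ _

theorem forwardInt_add_right (hf : CausalLocInt f) (hψ : IsForwardTest ψ) (hχ : IsForwardTest χ)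
    (x : ℝ) : forwardInt f (fun t => ψ t + χ t) x = forwardInt f ψ x + forwardInt f χ x := by
  unfold forwardInt
  simp_rw [mul_add]
  exact integral_add (integrableOn_mul_forwardTest hf hψ x) (integrableOn_mul_forwardTest hf hχ x)

theorem forwardInt_const_mul_right (c : ℝ) (f ψ : ℝ → ℝ) (x : ℝ) :
    forwardInt f (fun t => c * ψ t) x = c * forwardInt f ψ x := by
  unfold forwardInt
  simp_rw [mul_left_comm _ c]
  exact integral_const_mul _ _

theorem forwardInt_congr_left (h : EqOn f g (Ioi 0)) (ψ : ℝ → ℝ) (x : ℝ) :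
    forwardInt f ψ x = forwardInt g ψ x :=
  setIntegral_congr_fun measurableSet_Ioi fun s hs => by simp only [h hs]

theorem forwardInt_congr_right {x : ℝ} (f : ℝ → ℝ) (h : EqOn ψ χ (Ioi x)) :
    forwardInt f ψ x = forwardInt f χ x := by
  refine setIntegral_congr_fun measurableSet_Ioi fun s hs => ?_
  have hs0 : (0 : ℝ) < s := hs
  simp only [h (show x + s ∈ Ioi x from by simpa using hs0)]

/-! ### Causal convolution and Fubini -/

theorem integral_indicator_mul_indicator_sub {N t : ℝ} (ht0 : 0 < t) (htN : t ≤ N) :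
    ∫ s, indicator (Ioc 0 N) f s * indicator (Ioc 0 N) g (t - s) = causalConv f g t := by
  rw [causalConv, intervalIntegral.integral_of_le ht0.le, integral_Ioc_eq_integral_Ioo,
    ← integral_indicator measurableSet_Ioo]
  refine integral_congr_ae (Eventually.of_forall fun s => ?_)
  by_cases hs : s ∈ Ioo 0 t
  · simp only
    rw [indicator_of_mem hs, indicator_of_mem (show s ∈ Ioc 0 N from ⟨hs.1, by linarith [hs.2]⟩),
      indicator_of_mem (show t - s ∈ Ioc 0 N from ⟨by linarith [hs.2], by linarith [hs.1]⟩)]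
  · simp only
    rw [indicator_of_notMem hs]
    by_cases h0 : 0 < s
    · rw [indicator_of_notMem (s := Ioc 0 N) (a := t - s), mul_zero]
      intro h
      exact hs ⟨h0, by linarith [h.1]⟩
    · rw [indicator_of_notMem (s := Ioc 0 N) (a := s) (fun h => h0 h.1), zero_mul]

theorem causalConv_comm (f g : ℝ → ℝ) : causalConv f g = causalConv g f := by
  ext t
  have h := intervalIntegral.integral_comp_sub_left (fun s => g s * f (t - s)) t (a := 0) (b := t)
  rw [sub_self, sub_zero] at h
  rw [causalConv, causalConv, ← h]
  simp only [sub_sub_cancel, mul_comm]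

theorem CausalLocInt.integrable_indicator (hf : CausalLocInt f) (N : ℝ) :
    Integrable (indicator (Ioc 0 N) f) :=
  (integrable_indicator_iff measurableSet_Ioc).2 (hf N)

/-- Truncated to (0, N], both factors are integrable on the whole line, hence so is their
convolution; truncation does not affect it on (0, N]. -/
theorem CausalLocInt.causalConv (hf : CausalLocInt f) (hg : CausalLocInt g) :
    CausalLocInt (causalConv f g) := by
  intro N
  have h := ((hf.integrable_indicator N).convolution_integrand (ContinuousLinearMap.mul ℝ ℝ)
    (hg.integrable_indicator N)).integral_prod_left
  refine (h.integrableOn (s := Ioc 0 N)).congr_fun (fun t ht => ?_) measurableSet_Ioc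
  exact integral_indicator_mul_indicator_sub ht.1 ht.2

/-- Fubini with the substitution τ = r + s. -/
theorem forwardInt_forwardInt (hf : CausalLocInt f) (hg : CausalLocInt g) (hψ : IsForwardTest ψ)
    (x : ℝ) : forwardInt f (forwardInt g ψ) x = forwardInt (causalConv f g) ψ x := by
  obtain ⟨M, hM⟩ := hψ.exists_eq_zero
  obtain ⟨C, hC⟩ := hψ.exists_bound x
  -- Since ψ(x + τ) = 0 for τ ≥ N, truncating f and g to (0, N] loses nothing; cutting ρ to τ > 0
  -- makes it bounded.
  set N : ℝ := M - x with hN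
  let F := indicator (Ioc 0 N) f
  let G := indicator (Ioc 0 N) g
  let ρ : ℝ → ℝ := indicator (Ioi 0) fun τ => ψ (x + τ)
  have hρ0 : ∀ τ, N < τ → ρ τ = 0 := by
    intro τ h
    by_cases h0 : τ ∈ Ioi 0
    · exact (indicator_of_mem h0 _).trans (hM _ (by linarith))
    · exact indicator_of_notMem h0 _
  have hρm : Measurable ρ :=
    (hψ.continuous.comp (by fun_prop : Continuous fun τ => x + τ)).measurable.indicator
      measurableSet_Ioi
  have hρC : ∀ τ, ‖ρ τ‖ ≤ C := by
    intro τ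
    by_cases h0 : τ ∈ Ioi 0
    · simp only [ρ]
      rw [indicator_of_mem h0]
      exact hC _ (by linarith [mem_Ioi.1 h0])
    · simp only [ρ]
      rw [indicator_of_notMem h0, norm_zero]
      exact (abs_nonneg _).trans (hC x le_rfl)
  have hint : Integrable (fun p : ℝ × ℝ => ρ p.1 * (F p.2 * G (p.1 - p.2)))
      (volume.prod volume) :=
    ((hf.integrable_indicator N).convolution_integrand (ContinuousLinearMap.mul ℝ ℝ)
      (hg.integrable_indicator N)).bdd_mul (hρm.comp measurable_fst).aestronglyMeasurable
      (Eventually.of_forall fun p => hρC p.1)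
  have hswap := integral_integral_swap (f := fun τ s => ρ τ * (F s * G (τ - s))) hint
  have hR : forwardInt (causalConv f g) ψ x = ∫ τ, ∫ s, ρ τ * (F s * G (τ - s)) := by
    rw [forwardInt, ← integral_indicator measurableSet_Ioi]
    refine integral_congr_ae (Eventually.of_forall fun τ => ?_)
    simp only
    rw [integral_const_mul]
    by_cases h0 : τ ∈ Ioi 0
    · rw [indicator_of_mem h0]
      rcases le_or_gt τ N with h | h
      · rw [show (∫ s, F s * G (τ - s)) = causalConv f g τ from
          integral_indicator_mul_indicator_sub h0 h]
        simp only [ρ]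
        rw [indicator_of_mem h0, mul_comm]
      · rw [hρ0 τ h, hM _ (by linarith), mul_zero, zero_mul]
    · simp only [ρ]
      rw [indicator_of_notMem h0, indicator_of_notMem h0, zero_mul]
  have hL : forwardInt f (forwardInt g ψ) x = ∫ s, ∫ τ, ρ τ * (F s * G (τ - s)) := by
    rw [forwardInt, ← integral_indicator measurableSet_Ioi]
    refine integral_congr_ae (Eventually.of_forall fun s => ?_)
    simp only
    have h1 : ∫ τ, ρ τ * (F s * G (τ - s)) = F s * ∫ r, ρ (r + s) * G r := by
      rw [← integral_const_mul, ← integral_add_right_eq_self _ s]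
      refine integral_congr_ae (Eventually.of_forall fun r => ?_)
      simp only [add_sub_cancel_right]
      ring
    rw [h1]
    by_cases h0 : s ∈ Ioi 0
    · have hs0 : 0 < s := h0
      rw [indicator_of_mem h0]
      rcases le_or_gt s N with h | h
      · simp only [F]
        rw [indicator_of_mem (show s ∈ Ioc 0 N from ⟨h0, h⟩), forwardInt,
          ← integral_indicator measurableSet_Ioi]
        congr 1
        refine integral_congr_ae (Eventually.of_forall fun r => ?_)
        simp only
        by_cases hr : r ∈ Ioi 0
        · have hr0 : 0 < r := hr
          rw [indicator_of_mem hr]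
          rcases le_or_gt r N with h' | h'
          · simp only [ρ, G]
            rw [indicator_of_mem (show r ∈ Ioc 0 N from ⟨hr, h'⟩),
              indicator_of_mem (show r + s ∈ Ioi 0 from add_pos hr0 hs0), mul_comm]
            ring_nf
          · rw [hρ0 _ (by linarith), hM _ (by linarith), mul_zero, zero_mul]
        · simp only [G]
          rw [indicator_of_notMem hr, indicator_of_notMem (fun h => hr h.1), mul_zero]
      · simp only [F]
        rw [indicator_of_notMem (fun h' => absurd h'.2 (not_le.2 h)), zero_mul, forwardInt,
          setIntegral_eq_zero_of_forall_eq_zero, mul_zero]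
        intro r hr
        have hr0 : 0 < r := hr
        rw [hM _ (by linarith), mul_zero]
    · simp only [F]
      rw [indicator_of_notMem h0, indicator_of_notMem (fun h => h0 h.1), zero_mul]
  rw [hL, hR, hswap]

theorem forwardInt_comm (hf : CausalLocInt f) (hg : CausalLocInt g) (hψ : IsForwardTest ψ)
    (x : ℝ) : forwardInt f (forwardInt g ψ) x = forwardInt g (forwardInt f ψ) x := by
  rw [forwardInt_forwardInt hf hg hψ, forwardInt_forwardInt hg hf hψ, causalConv_comm]

/-- Integration by parts: `∫_0^∞ e(s) ψ'(x + s) ds = -e(0) ψ(x) - ∫_0^∞ e'(s) ψ(x + s) ds`. -/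
theorem forwardInt_deriv {e h ψ' : ℝ → ℝ} (he : Continuous e) (hh : CausalLocInt h)
    (hd : ∀ t, 0 < t → HasDerivAt e (h t) t) (hψ : IsForwardTest ψ) (hψ' : IsForwardTest ψ')
    (hψd : ∀ x, HasDerivAt ψ (ψ' x) x) (x : ℝ) :
    forwardInt e ψ' x = -(e 0 * ψ x) - forwardInt h ψ x := by
  obtain ⟨M, hM⟩ := hψ.exists_eq_zero
  obtain ⟨M', hM'⟩ := hψ'.exists_eq_zero
  -- Beyond x + N both ψ and ψ' vanish, so only the boundary term at 0 survives.
  set N : ℝ := max (max (M - x) (M' - x)) 0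
  have hN0 : 0 ≤ N := le_max_right _ _
  have hN1 : M ≤ x + N := by
    have := (le_max_left (M - x) (M' - x)).trans (le_max_left _ (0 : ℝ)); linarith
  have hN2 : M' ≤ x + N := by
    have := (le_max_right (M - x) (M' - x)).trans (le_max_left _ (0 : ℝ)); linarith
  have hψc : Continuous fun s => ψ (x + s) := hψ.continuous.comp (by fun_prop)
  have hψ'c : Continuous fun s => ψ' (x + s) := hψ'.continuous.comp (by fun_prop)
  have hi1 : IntervalIntegrable (fun s => h s * ψ (x + s)) volume 0 N :=
    (hh.mul_continuous hψc).intervalIntegrable hN0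
  have hi2 : IntervalIntegrable (fun s => e s * ψ' (x + s)) volume 0 N :=
    (he.mul hψ'c).intervalIntegrable _ _
  have key := intervalIntegral.integral_eq_sub_of_hasDerivAt_of_le hN0
    (he.mul hψc).continuousOn (f' := fun s => h s * ψ (x + s) + e s * ψ' (x + s))
    (fun s hs => (hd s hs.1).mul ((hψd (x + s)).comp_const_add x s)) (hi1.add hi2)
  rw [intervalIntegral.integral_add hi1 hi2,
    ← forwardInt_eq_intervalIntegral hN0 (fun s hs => hM _ (by linarith)),
    ← forwardInt_eq_intervalIntegral hN0 (fun s hs => hM' _ (by linarith)),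
    Pi.mul_apply, Pi.mul_apply, hM _ hN1, add_zero] at key
  linarith

/-! ### Smoothness of transposed convolutions -/

theorem forwardInt_eq_convolution (f ψ : ℝ → ℝ) :
    forwardInt f ψ = MeasureTheory.convolution (fun t => indicator (Ioi 0) f (-t)) ψ
      (ContinuousLinearMap.mul ℝ ℝ) volume := by
  ext x
  rw [MeasureTheory.convolution, forwardInt, ← integral_indicator measurableSet_Ioi,
    ← integral_neg_eq_self]
  refine integral_congr_ae (Eventually.of_forall fun t => ?_)
  simp only [ContinuousLinearMap.mul_apply', sub_eq_add_neg]
  by_cases h : -t ∈ Ioi (0 : ℝ)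
  · rw [indicator_of_mem h, indicator_of_mem h]
  · rw [indicator_of_notMem h, indicator_of_notMem h, zero_mul]

theorem CausalLocInt.locallyIntegrable_comp_neg (hf : CausalLocInt f) :
    LocallyIntegrable (fun t => indicator (Ioi 0) f (-t)) := by
  rw [locallyIntegrable_iff]
  intro k hk
  obtain ⟨N, hN⟩ := hk.bddBelow
  have h := ((hf.integrable_indicator (-N)).comp_neg).integrableOn (s := k)
  refine h.congr ?_
  filter_upwards [ae_restrict_mem hk.measurableSet] with t ht
  have htN := hN ht
  by_cases h0 : 0 < -t
  · rw [indicator_of_mem (show -t ∈ Ioc 0 (-N) from ⟨h0, by linarith⟩),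
      indicator_of_mem (show -t ∈ Ioi 0 from h0)]
  · rw [indicator_of_notMem (fun h => h0 h.1),
      indicator_of_notMem (show -t ∉ Ioi 0 from h0)]

theorem contDiff_forwardInt (hf : CausalLocInt f) (hψ : ContDiff ℝ ∞ ψ)
    (hs : HasCompactSupport ψ) : ContDiff ℝ ∞ (forwardInt f ψ) := by
  rw [forwardInt_eq_convolution]
  exact hs.contDiff_convolution_right _ hf.locallyIntegrable_comp_neg hψ

theorem hasDerivAt_forwardInt (hf : CausalLocInt f) (hψ : ContDiff ℝ ∞ ψ)
    (hs : HasCompactSupport ψ) (x : ℝ) :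
    HasDerivAt (forwardInt f ψ) (forwardInt f (deriv ψ) x) x := by
  rw [forwardInt_eq_convolution, forwardInt_eq_convolution]
  exact hs.hasDerivAt_convolution_right _ hf.locallyIntegrable_comp_neg
    (hψ.of_le (by norm_cast)) x

end forwardInt

/-! ### Causal distributions, their convolution and the Caputo derivative -/

theorem TestFn.isForwardTest (ζ : TestFn) : IsForwardTest ζ :=
  isForwardTest_of_hasCompactSupport ζ.continuous ζ.hasCompactSupport

theorem TestFn.isForwardTest_deriv (ζ : TestFn) : IsForwardTest (deriv ζ) :=
  isForwardTest_of_hasCompactSupport (ζ.contDiff.continuous_deriv (by norm_cast))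
    ζ.hasCompactSupport.deriv

theorem TestFn.hasDerivAt (ζ : TestFn) (x : ℝ) : HasDerivAt ζ (deriv ζ x) x :=
  (ζ.contDiff.differentiable (by norm_cast)).differentiableAt.hasDerivAt

theorem CausalLocInt.locallyIntegrable_indicator {φ : ℝ → ℝ} (hφ : CausalLocInt φ) :
    LocallyIntegrable (indicator (Ici 0) φ) := by
  rw [locallyIntegrable_iff]
  intro k hk
  obtain ⟨N, hN⟩ := hk.bddAbove
  rw [IntegrableOn, integrable_indicator_iff measurableSet_Ici, IntegrableOn,
    Measure.restrict_restrict measurableSet_Ici]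
  exact ((integrableOn_Icc_iff_integrableOn_Ioc).2 (hφ N)).mono_set fun x hx => ⟨hx.1, hN hx.2⟩

theorem causalDistr_apply {φ : ℝ → ℝ} (hφ : CausalLocInt φ) (ζ : TestFn) :
    causalDistr φ ζ = forwardInt φ ζ 0 := by
  have h : LocallyIntegrableOn (indicator (Ici 0) φ) ((⊤ : TopologicalSpace.Opens ℝ) : Set ℝ)
      volume := hφ.locallyIntegrable_indicator.locallyIntegrableOn _
  have h1 : causalDistr φ ζ = ∫ t, ζ t * indicator (Ici 0) φ t :=
    TestFunction.integralAgainstBilinCLM_eq_integral h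
  rw [h1, forwardInt, ← integral_Ici_eq_integral_Ioi, ← integral_indicator measurableSet_Ici]
  refine integral_congr_ae (Eventually.of_forall fun t => ?_)
  by_cases ht : t ∈ Ici (0 : ℝ)
  · simp [indicator_of_mem ht, mul_comm]
  · simp [indicator_of_notMem ht]

/-- The function `g_{1-γ}` on `(0, ∞)`. -/
noncomputable def caputoKernel (γ t : ℝ) : ℝ :=
  t ^ (1 - γ - 1) / Real.Gamma (1 - γ)

theorem causalLocInt_caputoKernel {γ : ℝ} (hγ : γ < 1) : CausalLocInt (caputoKernel γ) := by
  intro N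
  have h := intervalIntegral.intervalIntegrable_rpow' (r := 1 - γ - 1) (a := 0) (b := N)
    (by linarith)
  exact h.1.div_const _

theorem gPos_apply {γ : ℝ} (hγ : γ < 1) (ζ : TestFn) :
    gPos (1 - γ) ζ = forwardInt (caputoKernel γ) ζ 0 :=
  causalDistr_apply (causalLocInt_caputoKernel hγ) ζ

theorem gNeg_apply {γ : ℝ} (hγ : γ < 1) (ζ : TestFn) :
    gNeg γ ζ = -forwardInt (caputoKernel γ) (deriv ζ) 0 := by
  rw [gNeg, Distribution.lineDerivOp_apply_apply, map_neg, gPos_apply hγ]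
  rfl

theorem causalLocInt_mul_unityPart {φ : ℝ → ℝ} (hφ : CausalLocInt φ) (i : ℤ) :
    CausalLocInt fun t => φ t * unityPart i t :=
  hφ.mul_continuous (unityPart_contDiff i).continuous

theorem causalDistr_shiftedWindow {φ : ℝ → ℝ} (hφ : CausalLocInt φ) (i : ℤ) (ζ : TestFn) (s : ℝ) :
    causalDistr φ (shiftedWindow i ζ s) = forwardInt (fun t => φ t * unityPart i t) ζ s := by
  rw [causalDistr_apply hφ, forwardInt, forwardInt]
  refine setIntegral_congr_fun measurableSet_Ioi fun t _ => ?_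
  simp only [zero_add]
  rw [mul_assoc]
  rfl

theorem asTestFn_apply {ψ : ℝ → ℝ} (h1 : ContDiff ℝ ∞ ψ) (h2 : HasCompactSupport ψ) :
    (asTestFn ψ : ℝ → ℝ) = ψ := by
  rw [asTestFn, dif_pos ⟨h1, h2⟩]
  rfl

/-- The window bounds s on both sides, so the support is compact on the left too. Thus `asTestFn`
returns the function itself and not its default 0. -/
theorem hasCompactSupport_forwardInt_unityPart (φ : ℝ → ℝ) (i : ℤ) (ζ : TestFn) :
    HasCompactSupport (forwardInt (fun t => φ t * unityPart i t) ζ) := by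
  obtain ⟨M, hM⟩ := ζ.hasCompactSupport.isCompact.bddAbove
  obtain ⟨m, hm⟩ := ζ.hasCompactSupport.isCompact.bddBelow
  refine HasCompactSupport.intro (isCompact_Icc (a := m - (i + 1)) (b := M - (i - 1)))
    fun x hx => setIntegral_eq_zero_of_forall_eq_zero fun s _ => ?_
  by_cases hs : s ∈ Icc ((i : ℝ) - 1) (i + 1)
  · rw [image_eq_zero_of_notMem_tsupport (f := ζ) (x := x + s), mul_zero]
    intro h
    exact hx ⟨by linarith [hm h, hs.2], by linarith [hM h, hs.1]⟩
  · simp only [unityPart_eq_zero i s hs, mul_zero, zero_mul]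

theorem finsum_forwardInt_unityPart {φ ψ : ℝ → ℝ} (hφ : CausalLocInt φ) (hψ : IsForwardTest ψ) :
    ∑ᶠ i : ℤ, forwardInt (fun t => φ t * unityPart i t) ψ 0 = forwardInt φ ψ 0 := by
  obtain ⟨M, hM⟩ := hψ.exists_eq_zero
  -- The window [i-1, i+1] meets (0, M) only if -1 < i < M + 1.
  set I : Finset ℤ := Finset.Icc (-1) (⌈M⌉ + 1) with hI
  have hz : ∀ i ∉ I, ∀ t, 0 < t → t < M → unityPart i t = 0 := by
    intro i hi t ht0 htM
    refine unityPart_eq_zero i t fun h => hi (Finset.mem_Icc.2 ⟨?_, ?_⟩)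
    · have : (-1 : ℝ) < i := by linarith [h.2]
      exact_mod_cast this.le
    · have : (i : ℝ) ≤ ⌈M⌉ + 1 := by linarith [h.1, Int.le_ceil M]
      exact_mod_cast this
  have hsub : (Function.support fun i : ℤ => forwardInt (fun t => φ t * unityPart i t) ψ 0) ⊆
      (I : Set ℤ) := by
    intro i hi
    by_contra h
    refine hi (setIntegral_eq_zero_of_forall_eq_zero fun t ht => ?_)
    rcases lt_or_ge t M with htM | htM
    · simp only [hz i h t ht htM, mul_zero, zero_mul]
    · rw [zero_add, hM t htM, mul_zero]
  rw [finsum_eq_sum_of_support_subset _ hsub]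
  unfold forwardInt
  rw [← integral_finsetSum _ fun i _ =>
    integrableOn_mul_forwardTest (causalLocInt_mul_unityPart hφ i) hψ 0]
  refine setIntegral_congr_fun measurableSet_Ioi fun t ht => ?_
  rw [← Finset.sum_mul, ← Finset.mul_sum]
  rcases lt_or_ge t M with htM | htM
  · rw [← finsum_eq_sum_of_support_subset, finsum_unityPart, mul_one]
    intro i hi
    by_contra h
    exact hi (hz i h t ht htM)
  · rw [zero_add, hM t htM, mul_zero, mul_zero]

/-- Commuting the two operators puts the windowed factor outermost, where the partition of unity
sums to 1; commuting back restores the order. -/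
theorem convDistr_gNeg_causalDistr {γ : ℝ} (hγ : γ < 1) {φ : ℝ → ℝ} (hφ : CausalLocInt φ)
    (ζ : TestFn) : convDistr (gNeg γ) (causalDistr φ) ζ =
      -forwardInt (caputoKernel γ) (forwardInt φ (deriv ζ)) 0 := by
  have hk := causalLocInt_caputoKernel hγ
  have hterm : ∀ i : ℤ, gNeg γ (asTestFn fun s => causalDistr φ (shiftedWindow i ζ s)) =
      -forwardInt (fun t => φ t * unityPart i t)
        (forwardInt (caputoKernel γ) (deriv ζ)) 0 := by
    intro i
    have hφi := causalLocInt_mul_unityPart hφ i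
    rw [gNeg_apply hγ, funext (causalDistr_shiftedWindow hφ i ζ),
      asTestFn_apply (contDiff_forwardInt hφi ζ.contDiff ζ.hasCompactSupport)
        (hasCompactSupport_forwardInt_unityPart φ i ζ),
      funext fun x =>
        (hasDerivAt_forwardInt hφi ζ.contDiff ζ.hasCompactSupport x).deriv,
      forwardInt_comm hk hφi ζ.isForwardTest_deriv]
  rw [convDistr, finsum_congr hterm, finsum_neg_distrib,
    finsum_forwardInt_unityPart hφ (forwardInt_isForwardTest hk ζ.isForwardTest_deriv),
    forwardInt_comm hk hφ ζ.isForwardTest_deriv]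

theorem caputoDeriv_apply {γ : ℝ} (hγ : γ < 1) {φ : ℝ → ℝ} (hφ : CausalLocInt φ)
    (ζ : TestFn) : caputoDeriv γ φ ζ =
      -forwardInt (caputoKernel γ) (forwardInt φ (deriv ζ)) 0 -
        initialValue φ * forwardInt (caputoKernel γ) ζ 0 := by
  rw [caputoDeriv, convDistr_gNeg_causalDistr hγ hφ, gPos_apply hγ]

/-! ### Initial values -/

/-- The triangle inequality, averaged over (0, t). It makes the chosen `initialValue` independent of
the choice. -/
theorem HasInitialValue.unique {φ : ℝ → ℝ} (hφ : CausalLocInt φ) {C C' : ℝ}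
    (h : HasInitialValue φ C) (h' : HasInitialValue φ C') : C = C' := by
  have hb : ∀ᶠ t : ℝ in 𝓝[>] 0, |C - C'| ≤ (1 / t) * (∫ s in (0 : ℝ)..t, |φ s - C|) +
      (1 / t) * ∫ s in (0 : ℝ)..t, |φ s - C'| := by
    filter_upwards [self_mem_nhdsWithin] with t ht
    have ht0 : (0 : ℝ) < t := ht
    have hi : ∀ D : ℝ, IntervalIntegrable (fun s => |φ s - D|) volume 0 t := fun D =>
      ((hφ.intervalIntegrable ht0.le).sub intervalIntegrable_const).abs
    rw [← mul_add, ← intervalIntegral.integral_add (hi C) (hi C')]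
    have hle : ∫ s in (0 : ℝ)..t, |C - C'| ≤
        ∫ s in (0 : ℝ)..t, (|φ s - C| + |φ s - C'|) := by
      refine intervalIntegral.integral_mono_on ht0.le intervalIntegrable_const
        ((hi C).add (hi C')) fun s _ => ?_
      rw [abs_sub_comm (φ s) C]
      exact (abs_sub_le C (φ s) C')
    rw [intervalIntegral.integral_const, sub_zero, smul_eq_mul] at hle
    calc |C - C'| = (1 / t) * (t * |C - C'|) := by field_simp
      _ ≤ _ := by gcongr
  have hlim : |C - C'| ≤ 0 := by
    refine ge_of_tendsto ?_ hb
    simpa using h.add h'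
  exact sub_eq_zero.1 (abs_eq_zero.1 (le_antisymm hlim (abs_nonneg _)))

theorem initialValue_eq {φ : ℝ → ℝ} (hφ : CausalLocInt φ) {C : ℝ} (h : HasInitialValue φ C) :
    initialValue φ = C := by
  have hex : ∃ C, HasInitialValue φ C := ⟨C, h⟩
  rw [initialValue, dif_pos hex]
  exact hex.choose_spec.unique hφ h

theorem hasInitialValue_of_tendsto {φ : ℝ → ℝ} {C : ℝ} (h : Tendsto φ (𝓝[>] 0) (𝓝 C)) :
    HasInitialValue φ C := by
  rw [HasInitialValue, Metric.tendsto_nhds]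
  intro ε hε
  have hev := (Metric.tendsto_nhds.1 h) (ε / 2) (half_pos hε)
  obtain ⟨δ, hδ, hsub⟩ := mem_nhdsGT_iff_exists_Ioo_subset.1 hev
  filter_upwards [Ioo_mem_nhdsGT hδ] with t ht
  have hb : ‖∫ s in (0 : ℝ)..t, |φ s - C|‖ ≤ ε / 2 * |t - 0| := by
    refine intervalIntegral.norm_integral_le_of_norm_le_const fun s hs => ?_
    rw [uIoc_of_le ht.1.le] at hs
    have : dist (φ s) C < ε / 2 := hsub ⟨hs.1, hs.2.trans_lt ht.2⟩
    rw [norm_abs_eq_norm, Real.norm_eq_abs, ← Real.dist_eq]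
    exact this.le
  rw [sub_zero, abs_of_pos ht.1] at hb
  rw [dist_zero_right, norm_mul, Real.norm_of_nonneg (by have := ht.1; positivity)]
  have h0 := ht.1
  calc 1 / t * ‖∫ s in (0 : ℝ)..t, |φ s - C|‖ ≤ 1 / t * (ε / 2 * t) := by gcongr
    _ = ε / 2 := by field_simp
    _ < ε := half_lt_self hε

theorem causalLocInt_of_memX {φ : ℝ → ℝ} (h : MemX φ) : CausalLocInt φ :=
  locallyIntegrableOn_Ici_iff_causalLocInt.1 h.1

/-! ### The linear equation -/

section

variable {γ μ v₀ : ℝ} {b : ℝ → ℝ}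

theorem causalLocInt_mlResolvent (hγ : 0 < γ) (μ : ℝ) : CausalLocInt (mlResolvent γ μ) :=
  fun N => (intervalIntegrable_mlResolvent hγ μ 0 N).1

theorem causalLocInt_mlExp (hγ : 0 < γ) (μ : ℝ) : CausalLocInt (mlExp γ μ) :=
  (continuous_mlExp hγ μ).continuousOn.causalLocInt

theorem forwardInt_caputoKernel_mlResolvent (hγ0 : 0 < γ) (hγ1 : γ < 1) {ψ : ℝ → ℝ}
    (hψ : IsForwardTest ψ) (x : ℝ) :
    forwardInt (caputoKernel γ) (forwardInt (mlResolvent γ μ) ψ) x =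
      forwardInt (mlExp γ μ) ψ x := by
  rw [forwardInt_forwardInt (causalLocInt_caputoKernel hγ1) (causalLocInt_mlResolvent hγ0 μ) hψ]
  exact forwardInt_congr_left (fun t ht => integral_rpow_mul_mlResolvent hγ0 hγ1 μ ht) ψ x

/-- The transpose of D(u e) = δ + μ R; the delta comes from e(0) = 1. -/
theorem forwardInt_mlExp_deriv (hγ : 0 < γ) {ψ : ℝ → ℝ} (hψ : ContDiff ℝ ∞ ψ)
    (hs : HasCompactSupport ψ) :
    forwardInt (mlExp γ μ) (deriv ψ) =
      fun x => (-1) * ψ x + (-μ) * forwardInt (mlResolvent γ μ) ψ x := by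
  ext x
  rw [forwardInt_deriv (continuous_mlExp hγ μ) ((causalLocInt_mlResolvent hγ μ).const_mul μ)
    (fun t ht => hasDerivAt_mlExp hγ μ ht) (isForwardTest_of_hasCompactSupport hψ.continuous hs)
    (isForwardTest_of_hasCompactSupport (hψ.continuous_deriv (by norm_cast)) hs.deriv)
    (fun x => (hψ.differentiable (by norm_cast)).differentiableAt.hasDerivAt),
    forwardInt_const_mul_left, mlExp_zero hγ]
  ring

theorem deriv_mlExp (hγ : 0 < γ) (μ : ℝ) {t : ℝ} (ht : 0 < t) :
    deriv (mlExp γ μ) t = μ * mlResolvent γ μ t :=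
  (hasDerivAt_mlExp hγ μ ht).deriv

theorem linearFODEFormula_eq (hγ : 0 < γ) (hμ : μ ≠ 0) (b : ℝ → ℝ) (v₀ : ℝ) {t : ℝ} (ht : 0 ≤ t) :
    linearFODEFormula γ μ b v₀ t = v₀ * mlExp γ μ t + causalConv (mlResolvent γ μ) b t := by
  rw [linearFODEFormula, causalConv, ← intervalIntegral.integral_const_mul]
  congr 1
  rw [intervalIntegral.integral_of_le ht, intervalIntegral.integral_of_le ht]
  refine setIntegral_congr_fun measurableSet_Ioc fun s hs => ?_
  simp only [deriv_mlExp hγ μ hs.1]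
  field_simp

theorem intervalIntegrable_mul_deriv_mlExp (hγ : 0 < γ) (hb : ContinuousOn b (Ici 0)) {t : ℝ}
    (ht : 0 ≤ t) :
    IntervalIntegrable (fun s => b (t - s) * deriv (mlExp γ μ) s) volume 0 t := by
  have h1 : IntervalIntegrable (deriv (mlExp γ μ)) volume 0 t := by
    refine ((intervalIntegrable_mlResolvent hγ μ 0 t).const_mul μ).congr fun s hs => ?_
    rw [uIoc_of_le ht] at hs
    exact (deriv_mlExp hγ μ hs.1).symm
  refine h1.continuousOn_mul (hb.comp (by fun_prop) fun s hs => ?_)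
  rw [uIcc_of_le ht] at hs
  exact sub_nonneg.2 hs.2

theorem causalLocInt_linearFODEFormula (hγ : 0 < γ) (hμ : μ ≠ 0) (hb : CausalLocInt b) :
    CausalLocInt (linearFODEFormula γ μ b v₀) := fun N =>
  (((causalLocInt_mlExp hγ μ).const_mul v₀).add
    ((causalLocInt_mlResolvent hγ μ).causalConv hb) N).congr_fun
    (fun _ ht => (linearFODEFormula_eq hγ hμ b v₀ ht.1.le).symm) measurableSet_Ioc

theorem forwardInt_linearFODEFormula (hγ : 0 < γ) (hμ : μ ≠ 0) (hb : CausalLocInt b) {ψ : ℝ → ℝ}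
    (hψ : IsForwardTest ψ) (x : ℝ) :
    forwardInt (linearFODEFormula γ μ b v₀) ψ x = v₀ * forwardInt (mlExp γ μ) ψ x +
      forwardInt (mlResolvent γ μ) (forwardInt b ψ) x := by
  have hR := causalLocInt_mlResolvent hγ μ
  rw [forwardInt_forwardInt hR hb hψ, ← forwardInt_const_mul_left,
    ← forwardInt_add_left ((causalLocInt_mlExp hγ μ).const_mul v₀) (hR.causalConv hb) hψ]
  exact forwardInt_congr_left (fun t ht => linearFODEFormula_eq hγ hμ b v₀ (mem_Ioi.1 ht).le) ψ x

/-- After transposition, g_{1-γ} * R * b becomes e * b; moving D onto e then yields b + μ R * b, and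
likewise g_{1-γ} + μ e from g_{1-γ} * e. -/
theorem caputo_identity_linearFODEFormula (hγ0 : 0 < γ) (hγ1 : γ < 1) (hμ : μ ≠ 0)
    (hb : CausalLocInt b) (ζ : TestFn) :
    -forwardInt (caputoKernel γ) (forwardInt (linearFODEFormula γ μ b v₀) (deriv ζ)) 0 -
        v₀ * forwardInt (caputoKernel γ) ζ 0 =
      forwardInt (fun t => μ * linearFODEFormula γ μ b v₀ t + b t) ζ 0 := by
  have hk := causalLocInt_caputoKernel hγ1
  have hR := causalLocInt_mlResolvent hγ0 μ
  have he := causalLocInt_mlExp hγ0 μ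
  have hV := causalLocInt_linearFODEFormula (v₀ := v₀) hγ0 hμ hb
  have hζ := ζ.isForwardTest
  have hζ' := ζ.isForwardTest_deriv
  have hRζ := forwardInt_isForwardTest hR hζ
  have hbζ' := forwardInt_isForwardTest hb hζ'
  have hE := forwardInt_mlExp_deriv (μ := μ) hγ0 ζ.contDiff ζ.hasCompactSupport
  have h1 : ∀ f : ℝ → ℝ, CausalLocInt f → forwardInt f (forwardInt (mlExp γ μ) (deriv ζ)) 0 =
      -forwardInt f ζ 0 - μ * forwardInt f (forwardInt (mlResolvent γ μ) ζ) 0 := by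
    intro f hf
    rw [hE, forwardInt_add_right hf (hζ.const_mul _) (hRζ.const_mul _),
      forwardInt_const_mul_right, forwardInt_const_mul_right]
    ring
  rw [funext (forwardInt_linearFODEFormula hγ0 hμ hb hζ'),
    forwardInt_add_right hk ((forwardInt_isForwardTest he hζ').const_mul v₀)
      (forwardInt_isForwardTest hR hbζ'),
    forwardInt_const_mul_right, forwardInt_caputoKernel_mlResolvent hγ0 hγ1 hbζ',
    forwardInt_comm he hb hζ', h1 _ hk, h1 _ hb, forwardInt_caputoKernel_mlResolvent hγ0 hγ1 hζ,
    forwardInt_add_left (hV.const_mul μ) hb hζ, forwardInt_const_mul_left,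
    forwardInt_linearFODEFormula hγ0 hμ hb hζ, forwardInt_comm hR hb hζ]
  ring

/-- A locally integrable function `d` with `D (g_{1-γ} * d) = μ d` vanishes. -/
theorem forwardInt_eq_zero_of_homogeneous (hγ0 : 0 < γ) (hγ1 : γ < 1) {d : ℝ → ℝ}
    (hd : CausalLocInt d) (h : ∀ ζ : TestFn,
      -forwardInt (caputoKernel γ) (forwardInt d (deriv ζ)) 0 = μ * forwardInt d ζ 0)
    {ψ : ℝ → ℝ} (hψ : ContDiff ℝ ∞ ψ) (hs : HasCompactSupport ψ) :
    forwardInt d ψ 0 = 0 := by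
  have hk := causalLocInt_caputoKernel hγ1
  have hR := causalLocInt_mlResolvent hγ0 μ
  have hψf := isForwardTest_of_hasCompactSupport hψ.continuous hs
  have hψ'f : IsForwardTest (deriv ψ) :=
    isForwardTest_of_hasCompactSupport (hψ.continuous_deriv (by norm_cast)) hs.deriv
  have hRψ := forwardInt_isForwardTest hR hψf
  have hRψ' := forwardInt_isForwardTest hR hψ'f
  -- The wanted test function is the transpose of R applied to ψ, whose support may reach -∞. The
  -- equation sees only (0, ∞), so it is cut off on the left, with equality on the open set x > -1
  -- so that derivatives agree as well.
  let Z : ℝ → ℝ := fun x => Real.smoothTransition (x + 2) * forwardInt (mlResolvent γ μ) ψ x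
  have hZc : ContDiff ℝ ∞ Z :=
    (Real.smoothTransition.contDiff.comp (by fun_prop)).mul (contDiff_forwardInt hR hψ hs)
  have hZs : HasCompactSupport Z := by
    obtain ⟨M, hM⟩ := hRψ.exists_eq_zero
    refine HasCompactSupport.intro (isCompact_Icc (a := -2) (b := M)) fun x hx => ?_
    rw [mem_Icc, not_and_or, not_le, not_le] at hx
    rcases hx with hx | hx
    · simp only [Z]
      rw [Real.smoothTransition.zero_of_nonpos (by linarith), zero_mul]
    · simp only [Z]
      rw [hM x hx.le, mul_zero]
  have hZ : EqOn Z (forwardInt (mlResolvent γ μ) ψ) (Ioi (-1)) := fun x hx => by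
    have : (-1 : ℝ) < x := hx
    simp only [Z]
    rw [Real.smoothTransition.one_of_one_le (by linarith), one_mul]
  have hZ' : EqOn (deriv Z) (forwardInt (mlResolvent γ μ) (deriv ψ)) (Ioi (-1)) := fun x hx => by
    rw [(hZ.eventuallyEq_of_mem (Ioi_mem_nhds hx)).deriv_eq]
    exact (hasDerivAt_forwardInt hR hψ hs x).deriv
  have h0 := h (asTestFn Z)
  -- The left side becomes ⟨d, ψ⟩ + μ ⟨d, Rᵗψ⟩ and the right side μ ⟨d, Rᵗψ⟩.
  rw [asTestFn_apply hZc hZs,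
    forwardInt_congr_right d (hZ.mono (Ioi_subset_Ioi (by norm_num : (-1 : ℝ) ≤ 0))),
    forwardInt_congr_right (caputoKernel γ) (fun x hx => forwardInt_congr_right d
      (hZ'.mono (Ioi_subset_Ioi (by linarith [mem_Ioi.1 hx] : (-1 : ℝ) ≤ x)))),
    forwardInt_comm hk hd hRψ',
    funext (forwardInt_caputoKernel_mlResolvent hγ0 hγ1 hψ'f), forwardInt_mlExp_deriv hγ0 hψ hs,
    forwardInt_add_right hd (hψf.const_mul _) (hRψ.const_mul _),
    forwardInt_const_mul_right, forwardInt_const_mul_right] at h0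
  linarith

theorem ae_eq_zero_of_forwardInt_eq_zero {d : ℝ → ℝ} (hd : CausalLocInt d)
    (h : ∀ ψ : ℝ → ℝ, ContDiff ℝ ∞ ψ → HasCompactSupport ψ → forwardInt d ψ 0 = 0) :
    ∀ᵐ t ∂(volume.restrict (Ici (0 : ℝ))), d t = 0 := by
  rw [ae_restrict_iff' measurableSet_Ici]
  have h1 := ae_eq_zero_of_integral_contDiff_smul_eq_zero hd.locallyIntegrable_indicator
    fun ψ hψ hs => by
      refine Eq.trans ?_ (h ψ hψ hs)
      rw [forwardInt, ← integral_Ici_eq_integral_Ioi,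
        ← integral_indicator measurableSet_Ici]
      refine integral_congr_ae (Eventually.of_forall fun t => ?_)
      by_cases ht : t ∈ Ici (0 : ℝ)
      · simp [indicator_of_mem ht, mul_comm]
      · simp [indicator_of_notMem ht]
  filter_upwards [h1] with t ht ht0
  rwa [indicator_of_mem ht0] at ht

/-! ### Growth and initial value of the formula -/

theorem exists_exp_bound (hb : ContinuousOn b (Ici 0))
    (hgrowth : ∃ L : ℝ, 0 < L ∧
      Tendsto (fun t : ℝ => Real.exp (-(L * t)) * |b t|) atTop (𝓝 0)) :
    ∃ L B : ℝ, 0 < L ∧ 0 ≤ B ∧ ∀ t, 0 ≤ t → |b t| ≤ B * Real.exp (L * t) := by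
  obtain ⟨L, hL, hlim⟩ := hgrowth
  obtain ⟨T, hT⟩ := eventually_atTop.1 (hlim.eventually (ge_mem_nhds (zero_lt_one' ℝ)))
  obtain ⟨C, hC⟩ := (isCompact_Icc (a := 0) (b := T)).exists_bound_of_continuousOn
    (hb.mono Icc_subset_Ici_self)
  refine ⟨L, max C 1, hL, zero_le_one.trans (le_max_right _ _), fun t ht => ?_⟩
  rcases le_total t T with h | h
  · calc |b t| ≤ max C 1 * 1 := by rw [mul_one]; exact (hC t ⟨ht, h⟩).trans (le_max_left _ _)
      _ ≤ _ := by
        gcongr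
        exact Real.one_le_exp (by positivity)
  · calc |b t| = (Real.exp (-(L * t)) * |b t|) * Real.exp (L * t) := by
          rw [mul_right_comm, ← Real.exp_add]; simp
      _ ≤ max C 1 * Real.exp (L * t) := by
        gcongr
        exact (hT t h).trans (le_max_right _ _)

/-- |R| is dominated by the resolvent kernel for |μ|, whose integral is (e_{γ,|μ|}(t) - 1)/|μ|. This
tends to 0 with t and grows at most exponentially, so it serves both the initial value and the
growth. -/
theorem abs_causalConv_mlResolvent_le (hγ : 0 < γ) (hμ : μ ≠ 0) {L B : ℝ} (hL : 0 < L)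
    (hB : 0 ≤ B) (hbd : ∀ t, 0 ≤ t → |b t| ≤ B * Real.exp (L * t)) {t : ℝ} (ht : 0 ≤ t) :
    |causalConv (mlResolvent γ μ) b t| ≤ B * Real.exp (L * t) * ((mlExp γ |μ| t - 1) / |μ|) := by
  have hμ' : 0 < |μ| := abs_pos.2 hμ
  have h := intervalIntegral.norm_integral_le_of_norm_le ht
    (f := fun s => mlResolvent γ μ s * b (t - s))
    (g := fun s => B * Real.exp (L * t) / |μ| * (|μ| * mlResolvent γ |μ| s))
    (Eventually.of_forall fun s hs => ?_)
    (((intervalIntegrable_mlResolvent hγ |μ| 0 t).const_mul _).const_mul _)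
  · rw [intervalIntegral.integral_const_mul, integral_mlResolvent hγ |μ| ht] at h
    refine h.trans_eq ?_
    ring
  · have h1 := abs_mlResolvent_le hγ μ hs.1.le
    have h2 := hbd (t - s) (sub_nonneg.2 hs.2)
    have h3 : Real.exp (L * (t - s)) ≤ Real.exp (L * t) :=
      Real.exp_le_exp.2 (mul_le_mul_of_nonneg_left (by linarith [hs.1]) hL.le)
    have h4 := (abs_nonneg _).trans h1
    rw [norm_mul, Real.norm_eq_abs, Real.norm_eq_abs]
    calc |mlResolvent γ μ s| * |b (t - s)|
        ≤ mlResolvent γ |μ| s * (B * Real.exp (L * t)) := by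
          refine mul_le_mul h1 (h2.trans ?_) (abs_nonneg _) h4
          gcongr
      _ = _ := by field_simp

theorem hasInitialValue_linearFODEFormula (hγ : 0 < γ) (hμ : μ ≠ 0) {L B : ℝ} (hL : 0 < L)
    (hB : 0 ≤ B) (hbd : ∀ t, 0 ≤ t → |b t| ≤ B * Real.exp (L * t)) :
    HasInitialValue (linearFODEFormula γ μ b v₀) v₀ := by
  refine hasInitialValue_of_tendsto ?_
  have he : ∀ ν, Tendsto (mlExp γ ν) (𝓝[>] 0) (𝓝 1) := fun ν => by
    have := (continuous_mlExp hγ ν).tendsto 0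
    rw [mlExp_zero hγ] at this
    exact this.mono_left nhdsWithin_le_nhds
  have hexp : Tendsto (fun t => Real.exp (L * t)) (𝓝[>] 0) (𝓝 1) := by
    have : Continuous fun t => Real.exp (L * t) := by fun_prop
    simpa using (this.tendsto 0).mono_left nhdsWithin_le_nhds
  have hR : Tendsto (causalConv (mlResolvent γ μ) b) (𝓝[>] 0) (𝓝 0) := by
    refine squeeze_zero_norm' (a := fun t => B * Real.exp (L * t) * ((mlExp γ |μ| t - 1) / |μ|))
      ?_ ?_
    · filter_upwards [self_mem_nhdsWithin] with t ht
      exact abs_causalConv_mlResolvent_le hγ hμ hL hB hbd (mem_Ioi.1 ht).le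
    · simpa using (hexp.const_mul B).mul (((he |μ|).sub_const 1).div_const |μ|)
  have h := ((he μ).const_mul v₀).add hR
  rw [mul_one, add_zero] at h
  refine h.congr' ?_
  filter_upwards [self_mem_nhdsWithin] with t ht
  exact (linearFODEFormula_eq hγ hμ b v₀ (mem_Ioi.1 ht).le).symm

theorem abs_linearFODEFormula_le (hγ : 0 < γ) (hμ : μ ≠ 0) {L B : ℝ} (hL : 0 < L)
    (hB : 0 ≤ B) (hbd : ∀ t, 0 ≤ t → |b t| ≤ B * Real.exp (L * t)) :
    ∃ K c : ℝ, 0 ≤ c ∧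
      ∀ t, 0 ≤ t → |linearFODEFormula γ μ b v₀ t| ≤ K * Real.exp (c * t) := by
  have hμ' : 0 < |μ| := abs_pos.2 hμ
  set c : ℝ := (2 * |μ|) ^ (1 / γ) with hc
  have hc0 : 0 ≤ c := by positivity
  refine ⟨|v₀| * (2 * Real.exp 1) + B * (2 * Real.exp 1 / |μ|), c + L, by positivity,
    fun t ht => ?_⟩
  have h1 : |mlExp γ μ t| ≤ 2 * Real.exp 1 * Real.exp (c * t) := by
    have := abs_mlExp_le_exp hγ μ ht
    rw [Real.exp_add] at this
    linarith
  have h2 : mlExp γ |μ| t - 1 ≤ 2 * Real.exp 1 * Real.exp (c * t) := by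
    have := (le_abs_self _).trans (abs_mlExp_le_exp hγ |μ| ht)
    rw [Real.exp_add, abs_abs] at this
    linarith
  have h3 := abs_causalConv_mlResolvent_le hγ hμ hL hB hbd ht
  have h4 : Real.exp (c * t) ≤ Real.exp ((c + L) * t) := Real.exp_le_exp.2 (by nlinarith)
  have h5 : Real.exp ((c + L) * t) = Real.exp (c * t) * Real.exp (L * t) := by
    rw [← Real.exp_add]; ring_nf
  rw [linearFODEFormula_eq hγ hμ b v₀ ht]
  calc |v₀ * mlExp γ μ t + causalConv (mlResolvent γ μ) b t|
      ≤ |v₀| * |mlExp γ μ t| + |causalConv (mlResolvent γ μ) b t| := by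
        rw [← abs_mul]; exact abs_add_le _ _
    _ ≤ |v₀| * (2 * Real.exp 1 * Real.exp ((c + L) * t)) +
        B * Real.exp (L * t) * (2 * Real.exp 1 * Real.exp (c * t) / |μ|) := by
        gcongr
        · exact h1.trans (by gcongr)
        · exact h3.trans (by gcongr)
    _ = _ := by rw [h5]; ring

/-- The extra 1 in the weight leaves a factor e^(-t), hence at most |K| e^(-A) on [A, ∞). -/
theorem tendsto_eLpNorm_top_of_exp_bound {φ : ℝ → ℝ} {K c : ℝ}
    (h : ∀ t, 0 ≤ t → |φ t| ≤ K * Real.exp (c * t)) :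
    Tendsto (fun A : ℝ => eLpNorm (fun t => Real.exp (-((c + 1) * t)) * φ t) ⊤
      (volume.restrict (Ici A))) atTop (𝓝 0) := by
  have hlim : Tendsto (fun A : ℝ => ENNReal.ofReal (|K| * Real.exp (-A))) atTop (𝓝 0) := by
    have := ENNReal.tendsto_ofReal (Real.tendsto_exp_neg_atTop_nhds_zero.const_mul |K|)
    simpa using this
  refine tendsto_of_tendsto_of_tendsto_of_le_of_le' tendsto_const_nhds hlim
    (Eventually.of_forall fun _ => zero_le) ?_
  filter_upwards [eventually_ge_atTop 0] with A hA
  rw [eLpNorm_exponent_top]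
  refine eLpNormEssSup_le_of_ae_bound ?_
  filter_upwards [ae_restrict_mem measurableSet_Ici] with t ht
  have htA : A ≤ t := ht
  rw [norm_mul, Real.norm_of_nonneg (Real.exp_pos _).le, Real.norm_eq_abs]
  calc Real.exp (-((c + 1) * t)) * |φ t|
      ≤ Real.exp (-((c + 1) * t)) * (|K| * Real.exp (c * t)) := by
        gcongr
        exact (h t (hA.trans htA)).trans (by gcongr; exact le_abs_self K)
    _ = |K| * Real.exp (-t) := by
        rw [mul_left_comm, ← Real.exp_add]; ring_nf
    _ ≤ |K| * Real.exp (-A) := by gcongr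

end

theorem mainTheorem10 (γ : ℝ) (hγ0 : 0 < γ) (hγ1 : γ < 1) (μ : ℝ) (hμ : μ ≠ 0)
    (b : ℝ → ℝ) (hb : ContinuousOn b (Ici 0))
    (hgrowth : ∃ L : ℝ, 0 < L ∧
      Tendsto (fun t : ℝ => Real.exp (-(L * t)) * |b t|) atTop (𝓝 0))
    (v₀ : ℝ) :
    -- the series, the derivative and the integral in the formula are meaningful
    (∀ z : ℝ, Summable fun n : ℕ => z ^ n / Real.Gamma (γ * n + 1)) ∧
    (∀ t : ℝ, 0 < t → DifferentiableAt ℝ (mlExp γ μ) t) ∧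
    (∀ t : ℝ, 0 ≤ t →
      IntervalIntegrable (fun s => b (t - s) * deriv (mlExp γ μ) s) volume 0 t) ∧
    -- the formula gives a solution in the class
    MemEL (linearFODEFormula γ μ b v₀) ∧
    IsFODESolution γ (fun t x => μ * x + b t) v₀ (linearFODEFormula γ μ b v₀) ∧
    -- and it is the only one, up to equality almost everywhere on `[0, ∞)`
    ∀ w : ℝ → ℝ, MemEL w → IsFODESolution γ (fun t x => μ * x + b t) v₀ w →
      w =ᵐ[volume.restrict (Ici 0)] linearFODEFormula γ μ b v₀ := by
  have hbc : CausalLocInt b := hb.causalLocInt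
  obtain ⟨L, B, hL, hB, hbd⟩ := exists_exp_bound hb hgrowth
  have hVc : CausalLocInt (linearFODEFormula γ μ b v₀) :=
    causalLocInt_linearFODEFormula hγ0 hμ hbc
  have hV0 : HasInitialValue (linearFODEFormula γ μ b v₀) v₀ :=
    hasInitialValue_linearFODEFormula hγ0 hμ hL hB hbd
  have hVX : MemX (linearFODEFormula γ μ b v₀) :=
    ⟨locallyIntegrableOn_Ici_iff_causalLocInt.2 hVc, v₀, hV0⟩
  have hf : ∀ {w : ℝ → ℝ}, CausalLocInt w → CausalLocInt fun t => μ * w t + b t :=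
    fun hw => (hw.const_mul μ).add hbc
  refine ⟨summable_mittagLefflerTwo hγ0 one_pos,
    fun t ht => (hasDerivAt_mlExp hγ0 μ ht).differentiableAt,
    fun t ht => intervalIntegrable_mul_deriv_mlExp hγ0 hb ht, ⟨hVX, ?_⟩,
    ⟨hVX, initialValue_eq hVc hV0, locallyIntegrableOn_Ici_iff_causalLocInt.2 (hf hVc),
      fun ζ => ?_⟩, fun w _ hw => ?_⟩
  · obtain ⟨K, c, hc, hK⟩ := abs_linearFODEFormula_le (v₀ := v₀) hγ0 hμ hL hB hbd
    exact ⟨c + 1, by positivity, tendsto_eLpNorm_top_of_exp_bound hK⟩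
  · rw [caputoDeriv_apply hγ1 hVc, initialValue_eq hVc hV0, causalDistr_apply (hf hVc)]
    exact caputo_identity_linearFODEFormula hγ0 hγ1 hμ hbc ζ
  · obtain ⟨hwX, hw0, _, hweq⟩ := hw
    have hwc := causalLocInt_of_memX hwX
    have hk := causalLocInt_caputoKernel hγ1
    -- In the difference of the two equations the terms v₀ g_{1-γ} and b cancel, leaving the
    -- homogeneous equation.
    have hd := ae_eq_zero_of_forwardInt_eq_zero (hwc.sub hVc) fun ψ hψ hs =>
      forwardInt_eq_zero_of_homogeneous (μ := μ) hγ0 hγ1 (hwc.sub hVc) (fun ζ => ?_) hψ hs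
    · filter_upwards [hd] with t ht using sub_eq_zero.1 ht
    · have hζ := ζ.isForwardTest
      have hζ' := ζ.isForwardTest_deriv
      have h1 := hweq ζ
      have h2 := caputo_identity_linearFODEFormula (v₀ := v₀) hγ0 hγ1 hμ hbc ζ
      rw [caputoDeriv_apply hγ1 hwc, hw0, causalDistr_apply (hf hwc),
        forwardInt_add_left (hwc.const_mul μ) hbc hζ, forwardInt_const_mul_left] at h1
      rw [forwardInt_add_left (hVc.const_mul μ) hbc hζ, forwardInt_const_mul_left] at h2
      have h3 : forwardInt (fun t => w t - linearFODEFormula γ μ b v₀ t) (deriv ζ) = fun x =>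
          forwardInt w (deriv ζ) x +
            (-1) * forwardInt (linearFODEFormula γ μ b v₀) (deriv ζ) x := by
        ext x
        rw [forwardInt_sub_left hwc hVc hζ']
        ring
      rw [h3, forwardInt_add_right hk (forwardInt_isForwardTest hwc hζ')
        ((forwardInt_isForwardTest hVc hζ').const_mul _), forwardInt_const_mul_right,
        forwardInt_sub_left hwc hVc hζ]
      linarith
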